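/- Let $n\ge 3$ and $k\ge 1$ be integers with $\alpha=2k<n$. There is a constant $c>0$, depending only on $n$ and $k$, with the following property. Let $L\in\mathbb N$, $\sigma_1,\dots,\sigma_L\in[0,2k)$, and for $i=1,\dots,L$ let $f_i(x,v)$ be a function that is smooth and positive for $(x,v)\in\mathbb R^n\times(0,\infty)^L$, with $f_i(x,0)=0$. Consider the systems $$u_i(x)=\lambda\int_{\mathbb R^n}\frac{f_i(y,u_1(y),\dots,u_L(y))}{|x-y|^{n-2k}|y|^{\sigma_i}}\,dy,\qquad i=1,\dots,L,\qquad (\mathrm{I}_\lambda)$$ with a constant $\lambda>0$, the integrals being convergent, and $$(-\Delta)^k u_i(x)=|x|^{-\sigma_i}f_i(x,u_1(x),\dots,u_L(x)),\qquad x\in\mathbb R^n\setminus\{0\},\ i=1,\dots,L.\qquad (\mathrm{D})$$ A solution $u=(u_1,\dots,u_L)$ of either system is always understood to be positive and classical: $u_i>0$ on $\mathbb R^n$ and $u_i\in C^{2k}(\mathbb R^n\setminus\{0\})\cap C(\mathbb R^n)$. Consider only functions $u$ for which there are $p_1,\dots,p_L>1$, $\sigma\in[0,2k)$ and $C>0$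 (possibly depending on $u$) such that $$\sum_{i=1}^L|x|^{-\sigma_i}f_i(x,u_1(x),\dots,u_L(x))\ \ge\ C|x|^{-\sigma}\sum_{i=1}^L u_i(x)^{p_i}\qquad\text{for all }x\ne0.$$ Then (D) and the integral system are equivalent up to a multiplicative constant: 1. If $u$ solves (D), then $u$ solves $(\mathrm{I}_c)$ for every $x\in\mathbb R^n$. Conversely, if $u$ solves $(\mathrm{I}_c)$ for every $x\ne 0$, then $u$ solves (D). 2. Suppose that $f$ is quasi-homogeneous in $v$, that is, there are $a_1,\dots,a_L\in\mathbb R$ with $f_i(x,s^{a_1}v_1,\dots,s^{a_L}v_L)=s^{a_i+1}f_i(x,v)$ for all $i$, $x\in\mathbb R^n$, $v\in(0,\infty)^L$, $s>0$. Then there are constants $t_1,\dots,t_L>0$, independent of $u$, such that: if $u$ solves $(\mathrm{I}_1)$ for every $x\ne0$, then $(t_1u_1,\dots,t_Lu_L)$ solves (D); and if $u$ solves (D), then $(t_1^{-1}u_1,\dots,t_L^{-1}u_L)$ solves $(\mathrm{I}_1)$ for every $x\in\mathbb R^n$. -/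

import Mathlib

open scoped ContDiff

noncomputable section

/-- Euclidean space `ℝⁿ`. -/
abbrev Rn (n : ℕ) : Type := EuclideanSpace ℝ (Fin n)

/-- The `k`-fold iterate `(-Δ)^k w`, computed pointwise with classical derivatives. At `x ≠ 0` it
depends only on `w` near `x`, so it is the classical operator wherever `w` is `C^{2k}`. -/
def negLaplacianPow (n k : ℕ) (w : Rn n → ℝ) : Rn n → ℝ :=
  (fun (v : Rn n → ℝ) (x : Rn n) => -(Laplacian.laplacian v x))^[k] w

/-- The assumptions on the data: `σ i ∈ [0, 2k)`, each nonlinearity `f i` is smooth in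
`(x, u) ∈ ℝⁿ × (0,∞)^L` and positive there, and `f i x 0 = 0`. -/
structure AdmissibleData (n k L : ℕ) (σ : Fin L → ℝ)
    (f : Fin L → Rn n → (Fin L → ℝ) → ℝ) : Prop where
  weight_nonneg : ∀ i, 0 ≤ σ i
  weight_lt : ∀ i, σ i < 2 * (k : ℝ)
  smooth : ∀ i, ContDiffOn ℝ ∞ (fun z : Rn n × (Fin L → ℝ) => f i z.1 z.2)
    {z | ∀ j, 0 < z.2 j}
  pos : ∀ i x (v : Fin L → ℝ), (∀ j, 0 < v j) → 0 < f i x v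
  zero : ∀ i x, f i x 0 = 0

/-- All components are positive and belong to `C^{2k}(ℝⁿ ∖ {0}) ∩ C(ℝⁿ)`. -/
structure PositiveClassical (n k L : ℕ) (u : Fin L → Rn n → ℝ) : Prop where
  pos : ∀ i x, 0 < u i x
  cont : ∀ i, Continuous (u i)
  smooth : ∀ i, ContDiffOn ℝ ((2 * k : ℕ) : ℕ∞) (u i) {x | x ≠ 0}

/-- The growth condition along `u`: for some `p i > 1`, `s ∈ [0, 2k)` and `C > 0`,
`∑ i, |x|^(-σ i) f i (x, u x) ≥ C |x|^(-s) ∑ i, (u i x)^(p i)` for all `x ≠ 0`. -/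
def GrowthCondition (n k L : ℕ) (σ : Fin L → ℝ) (f : Fin L → Rn n → (Fin L → ℝ) → ℝ)
    (u : Fin L → Rn n → ℝ) : Prop :=
  ∃ (p : Fin L → ℝ) (s C : ℝ), (∀ i, 1 < p i) ∧ 0 ≤ s ∧ s < 2 * (k : ℝ) ∧ 0 < C ∧
    ∀ x : Rn n, x ≠ 0 →
      C * ‖x‖ ^ (-s) * ∑ i, (u i x) ^ (p i) ≤ ∑ i, ‖x‖ ^ (-σ i) * f i x (fun j => u j x)

/-- `u` is a positive classical solution of `(-Δ)^k u_i = |x|^(-σ_i) f_i(x, u)` in `ℝⁿ ∖ {0}`. -/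
def IsDifferentialSolution (n k L : ℕ) (σ : Fin L → ℝ) (f : Fin L → Rn n → (Fin L → ℝ) → ℝ)
    (u : Fin L → Rn n → ℝ) : Prop :=
  PositiveClassical n k L u ∧
    ∀ i, ∀ x : Rn n, x ≠ 0 →
      negLaplacianPow n k (u i) x = ‖x‖ ^ (-σ i) * f i x (fun j => u j x)

/-- The integrand `f_i(y, u(y)) / (|x - y|^(n - 2k) |y|^(σ_i))`. -/
def rieszIntegrand (n k L : ℕ) (σ : Fin L → ℝ) (f : Fin L → Rn n → (Fin L → ℝ) → ℝ)
    (u : Fin L → Rn n → ℝ) (i : Fin L) (x y : Rn n) : ℝ :=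
  1 / (‖x - y‖ ^ ((n : ℝ) - 2 * (k : ℝ)) * ‖y‖ ^ (σ i)) * f i y (fun j => u j y)

/-- `u` is positive and classical and, for all `x ∈ D`, solves the integral system with the
constant `c` in front: `u_i(x) = c ∫ f_i(y, u(y)) / (|x - y|^(n - 2k) |y|^(σ_i)) dy`,
the integrals being convergent. -/
def IsIntegralSolutionOn (n k L : ℕ) (σ : Fin L → ℝ) (f : Fin L → Rn n → (Fin L → ℝ) → ℝ)
    (c : ℝ) (D : Set (Rn n)) (u : Fin L → Rn n → ℝ) : Prop :=
  PositiveClassical n k L u ∧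
    ∀ i, ∀ x ∈ D,
      MeasureTheory.Integrable (rieszIntegrand n k L σ f u i x) MeasureTheory.volume ∧
        u i x = c * ∫ y, rieszIntegrand n k L σ f u i x y

/-- Quasi-homogeneity of the nonlinearities in `u`, with weights `a`:
`f_i(x, s^(a_1) v_1, …, s^(a_L) v_L) = s^(a_i + 1) f_i(x, v)` for `s > 0` and `v` positive. -/
def QuasiHomogeneous (n L : ℕ) (f : Fin L → Rn n → (Fin L → ℝ) → ℝ) (a : Fin L → ℝ) : Prop :=
  ∀ i x (v : Fin L → ℝ), (∀ j, 0 < v j) → ∀ s : ℝ, 0 < s →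
    f i x (fun j => s ^ (a j) * v j) = s ^ (a i + 1) * f i x v

end

noncomputable section

open MeasureTheory Filter Topology Metric

/-! Every implication passes through `u` being the Riesz potential of `h = (-Δ)^k u`, and `c` is the
inverse of `bubbleMass`, the total mass of `(-Δ)^k (|y|² + 1)^(-(n-2k)/2)`.

From (D) to the integral system, three observations suffice; the signs of the intermediate iterates
`(-Δ)^j u` play no role. The origin is removable: a cutoff at scale `δ` costs `δ^(-2k)` on a ball of
volume of order `δ^n`, and `2k < n`, so the equation holds against all nonnegative test functions in
`C^{2k}` with compact support (`integral_mul_negLaplacianPow_of_nonneg`). The averages of each `u_i`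
over large balls vanish in the limit: testing with powers of `(1 - |y|²/R²)₊` and absorbing `u_i` by
Young's inequality and the growth condition bounds the total of the right-hand sides over `B_R` by
`O(R^(n-2k))`. The growth condition then bounds the averages of `u_i^(p_i)` by `O(R^(s-2k))`, and `s
< 2k` (`eventually_setIntegral_closedBall_le`). Finally the test function is the regularized
fundamental solution `ρ^(-(n-2k)/2)`, `ρ = |y - x₀|² + ε²`, cut off at radius of order `R`. Within
`R` of `x₀` its iterated Laplacian is exactly a positive bubble concentrating at `x₀`; beyond, it is
`O(R^(-n))` and supported in a ball of radius `2R`, so the error is an average of `u` over that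
ball. Letting `ε → 0` and then `R → ∞`, by monotone convergence, gives the representation at every
`x₀`, the origin included (`lintegral_riesz_eq`).

Conversely, Fubini and the identity for the fundamental solution show that a Riesz potential solves
the equation weakly off the origin, and continuity of both sides makes this pointwise
(`negLaplacianPow_eq_of_riesz`). Under quasi-homogeneity, multiplying `u_i` by `r^(a_i)` divides the
constant of the integral system by `r` (`IsIntegralSolutionOn.scale`), so `t_i` is the `a_i`-th
power of the mass. -/

/-! ### The iterated Laplacian: regularity, locality, integration by parts. -/

lemma laplacian_apply {n : ℕ} (f : Rn n → ℝ) (x : Rn n) :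
    Laplacian.laplacian f x = ∑ i, fderiv ℝ (fderiv ℝ f) x (EuclideanSpace.basisFun (Fin n) ℝ i)
      (EuclideanSpace.basisFun (Fin n) ℝ i) := by
  rw [InnerProductSpace.laplacian_eq_iteratedFDeriv_orthonormalBasis f
    (EuclideanSpace.basisFun (Fin n) ℝ)]
  simp [iteratedFDeriv_two_apply]

lemma contDiff_laplacian {n m : ℕ} {f : Rn n → ℝ} (hf : ContDiff ℝ ((m + 2 : ℕ) : ℕ∞ω) f) :
    ContDiff ℝ m (Laplacian.laplacian f) := by
  have h1 : ContDiff ℝ ((m + 1 : ℕ) : ℕ∞ω) (fderiv ℝ f) :=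
    hf.fderiv_right (by norm_cast)
  have h2 : ContDiff ℝ m (fderiv ℝ (fderiv ℝ f)) := h1.fderiv_right (by norm_cast)
  have e : Laplacian.laplacian f = fun x => ∑ i, fderiv ℝ (fderiv ℝ f) x
      (EuclideanSpace.basisFun (Fin n) ℝ i) (EuclideanSpace.basisFun (Fin n) ℝ i) :=
    funext (laplacian_apply f)
  rw [e]
  exact ContDiff.sum fun i _ => (h2.clm_apply contDiff_const).clm_apply contDiff_const

lemma negLaplacianPow_zero {n : ℕ} (f : Rn n → ℝ) : negLaplacianPow n 0 f = f := rfl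

lemma negLaplacianPow_succ {n k : ℕ} (f : Rn n → ℝ) :
    negLaplacianPow n (k + 1) f = negLaplacianPow n k (fun x => -(Laplacian.laplacian f x)) := rfl

lemma negLaplacianPow_succ' {n k : ℕ} (f : Rn n → ℝ) :
    negLaplacianPow n (k + 1) f = fun x => -(Laplacian.laplacian (negLaplacianPow n k f) x) := by
  unfold negLaplacianPow
  rw [Function.iterate_succ_apply']

lemma contDiff_negLaplacianPow {n m : ℕ} (k : ℕ) {f : Rn n → ℝ}
    (hf : ContDiff ℝ ((m + 2 * k : ℕ) : ℕ∞ω) f) : ContDiff ℝ m (negLaplacianPow n k f) := by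
  induction k generalizing f with
  | zero => simpa [negLaplacianPow_zero] using hf
  | succ k ih =>
    rw [negLaplacianPow_succ]
    exact ih (contDiff_laplacian (m := m + 2 * k) (by convert hf using 2; ring)).neg

lemma continuous_negLaplacianPow {n k : ℕ} {f : Rn n → ℝ}
    (hf : ContDiff ℝ ((2 * k : ℕ) : ℕ∞ω) f) : Continuous (negLaplacianPow n k f) :=
  (contDiff_negLaplacianPow (m := 0) k (by simpa using hf)).continuous

lemma negLaplacianPow_congr {n : ℕ} (k : ℕ) {f g : Rn n → ℝ} {x : Rn n} (h : f =ᶠ[nhds x] g) :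
    negLaplacianPow n k f =ᶠ[nhds x] negLaplacianPow n k g := by
  induction k with
  | zero => exact h
  | succ k ih =>
    rw [negLaplacianPow_succ', negLaplacianPow_succ']
    filter_upwards [InnerProductSpace.laplacian_congr_nhds ih] with y hy
    rw [hy]

lemma negLaplacianPow_fun_zero {n : ℕ} (k : ℕ) :
    negLaplacianPow n k (fun _ => (0 : ℝ)) = fun _ => 0 := by
  induction k with
  | zero => rfl
  | succ k ih =>
    rw [negLaplacianPow_succ', ih]
    ext x
    simp [laplacian_apply]

lemma tsupport_negLaplacianPow_subset {n : ℕ} (k : ℕ) (f : Rn n → ℝ) :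
    tsupport (negLaplacianPow n k f) ⊆ tsupport f := by
  refine closure_minimal (fun x hx => ?_) (isClosed_tsupport f)
  by_contra hxf
  apply hx
  have h := negLaplacianPow_congr k (notMem_tsupport_iff_eventuallyEq.mp hxf)
  have h2 := h.eq_of_nhds
  rw [h2]
  exact congrFun (negLaplacianPow_fun_zero k) x

lemma HasCompactSupport.negLaplacianPow {n : ℕ} (k : ℕ) {f : Rn n → ℝ} (hf : HasCompactSupport f) :
    HasCompactSupport (negLaplacianPow n k f) :=
  hf.mono' ((subset_tsupport _).trans (tsupport_negLaplacianPow_subset k f))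

lemma integral_mul_laplacian {n : ℕ} {f g : Rn n → ℝ} (hf : ContDiff ℝ 2 f) (hg : ContDiff ℝ 2 g)
    (hgc : HasCompactSupport g) :
    ∫ x, f x * Laplacian.laplacian g x = ∫ x, Laplacian.laplacian f x * g x := by
  have hf1 : ContDiff ℝ 1 (fderiv ℝ f) := hf.fderiv_right (by norm_num)
  have hg1 : ContDiff ℝ 1 (fderiv ℝ g) := hg.fderiv_right (by norm_num)
  have hf2 : Continuous (fderiv ℝ (fderiv ℝ f)) := hf1.continuous_fderiv (by norm_num)
  have hg2 : Continuous (fderiv ℝ (fderiv ℝ g)) := hg1.continuous_fderiv (by norm_num)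
  have hfd : Differentiable ℝ (fderiv ℝ f) := hf1.differentiable (by norm_num)
  have hgd : Differentiable ℝ (fderiv ℝ g) := hg1.differentiable (by norm_num)
  have hc1 := hf1.continuous
  have hc2 := hg1.continuous
  have hc3 := hf.continuous
  have hc4 := hg.continuous
  have hs1 : HasCompactSupport (fderiv ℝ g) := hgc.fderiv ℝ
  have hs2 : HasCompactSupport (fderiv ℝ (fderiv ℝ g)) := hs1.fderiv ℝ
  have key : ∀ v : Rn n, ∫ x, f x * fderiv ℝ (fderiv ℝ g) x v v
      = ∫ x, fderiv ℝ (fderiv ℝ f) x v v * g x := by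
    intro v
    have es1 : HasCompactSupport (fun x => fderiv ℝ g x v) := hgc.fderiv_apply ℝ v
    have eg : ∀ x, fderiv ℝ (fun y => fderiv ℝ g y v) x v = fderiv ℝ (fderiv ℝ g) x v v := by
      intro x; rw [fderiv_clm_apply (hgd x) (by fun_prop)]; simp
    have ef : ∀ x, fderiv ℝ (fun y => fderiv ℝ f y v) x v = fderiv ℝ (fderiv ℝ f) x v v := by
      intro x; rw [fderiv_clm_apply (hfd x) (by fun_prop)]; simp
    have es2 : HasCompactSupport (fun x => fderiv ℝ (fderiv ℝ g) x v v) := by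
      have := es1.fderiv_apply ℝ v
      simpa only [eg] using this
    have h1 := integral_mul_fderiv_eq_neg_fderiv_mul_of_integrable (μ := (volume : Measure (Rn n)))
      (f := f) (g := fun y => fderiv ℝ g y v) (v := v)
      (Continuous.integrable_of_hasCompactSupport (by fun_prop) es1.mul_left)
      (by simp only [eg]
          exact Continuous.integrable_of_hasCompactSupport (by fun_prop) es2.mul_left)
      (Continuous.integrable_of_hasCompactSupport (by fun_prop) es1.mul_left)
      (fun x _ => hf.differentiable (by norm_num) x) (fun x _ => by fun_prop)
    have h2 := integral_mul_fderiv_eq_neg_fderiv_mul_of_integrable (μ := (volume : Measure (Rn n)))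
      (f := fun y => fderiv ℝ f y v) (g := g) (v := v)
      (by simp only [ef]
          exact Continuous.integrable_of_hasCompactSupport (by fun_prop) hgc.mul_left)
      (Continuous.integrable_of_hasCompactSupport (by fun_prop) es1.mul_left)
      (Continuous.integrable_of_hasCompactSupport (by fun_prop) hgc.mul_left)
      (fun x _ => by fun_prop) (fun x _ => hg.differentiable (by norm_num) x)
    simp only [eg] at h1
    simp only [ef] at h2
    rw [h1, h2, neg_neg]
  simp only [laplacian_apply, Finset.mul_sum, Finset.sum_mul]
  rw [integral_finsetSum, integral_finsetSum]
  · exact Finset.sum_congr rfl fun i _ => key _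
  · intro i _
    exact Continuous.integrable_of_hasCompactSupport (by fun_prop) hgc.mul_left
  · intro i _
    refine Continuous.integrable_of_hasCompactSupport (by fun_prop) (HasCompactSupport.mul_left ?_)
    exact hs2.comp_left (g := fun B : Rn n →L[ℝ] Rn n →L[ℝ] ℝ =>
      B (EuclideanSpace.basisFun (Fin n) ℝ i) (EuclideanSpace.basisFun (Fin n) ℝ i)) (by simp)

/-- The induction takes the outermost Laplacian off the iterate of `g` and puts it on `f` as the
innermost one; hence `f` varies in the induction while `g` stays fixed. Compact support of `g` alone
removes the boundary terms. -/
lemma integral_mul_negLaplacianPow {n : ℕ} (k : ℕ) {f g : Rn n → ℝ}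
    (hf : ContDiff ℝ ((2 * k : ℕ) : ℕ∞ω) f) (hg : ContDiff ℝ ((2 * k : ℕ) : ℕ∞ω) g)
    (hgc : HasCompactSupport g) :
    ∫ x, f x * negLaplacianPow n k g x = ∫ x, negLaplacianPow n k f x * g x := by
  induction k generalizing f with
  | zero => rfl
  | succ k ih =>
    have h2 : ContDiff ℝ 2 (negLaplacianPow n k g) :=
      contDiff_negLaplacianPow (m := 2) k (by convert hg using 2; ring)
    have h3 : ContDiff ℝ 2 f := hf.of_le (by norm_cast; omega)
    rw [negLaplacianPow_succ' g, negLaplacianPow_succ f]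
    have h4 := integral_mul_laplacian h3 h2 (hgc.negLaplacianPow k)
    simp only [mul_neg, integral_neg]
    rw [h4, ← integral_neg]
    rw [← ih (f := fun x => -(Laplacian.laplacian f x)) ?_ (hg.of_le (by norm_cast; omega))]
    · simp
    · exact (contDiff_laplacian (by convert hf using 2; ring)).neg

/-- Only the derivative of top order `2k` appears on the right, so that Leibniz's rule for a product
with a rescaled cutoff yields a clean power of the scale. -/
lemma norm_negLaplacianPow_le {n : ℕ} (k : ℕ) : ∃ C : ℝ, 0 ≤ C ∧ ∀ f : Rn n → ℝ,
    ContDiff ℝ ((2 * k : ℕ) : ℕ∞ω) f → ∀ x,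
      |negLaplacianPow n k f x| ≤ C * ‖iteratedFDeriv ℝ (2 * k) f x‖ := by
  induction k with
  | zero => exact ⟨1, zero_le_one, fun f _ x => by simp [negLaplacianPow_zero]⟩
  | succ k ih =>
    obtain ⟨C, hC, h⟩ := ih
    refine ⟨C * n, by positivity, fun f hf x => ?_⟩
    rw [negLaplacianPow_succ]
    have h1 : ContDiff ℝ ((2 * k : ℕ) : ℕ∞ω) (Laplacian.laplacian f) :=
      contDiff_laplacian (by convert hf using 2; ring)
    have h2 : ContDiff ℝ ((2 * k : ℕ) : ℕ∞ω) (fderiv ℝ (fderiv ℝ f)) := by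
      have h1 : ContDiff ℝ ((2 * k + 1 : ℕ) : ℕ∞ω) (fderiv ℝ f) :=
        hf.fderiv_right (by norm_cast)
      exact h1.fderiv_right (by norm_cast)
    refine (h _ h1.neg x).trans ?_
    rw [mul_assoc]
    gcongr
    have e : (fun x => -(Laplacian.laplacian f x)) = (-Laplacian.laplacian f) := rfl
    have e' : Laplacian.laplacian f = fun x => ∑ i, fderiv ℝ (fderiv ℝ f) x
      (EuclideanSpace.basisFun (Fin n) ℝ i) (EuclideanSpace.basisFun (Fin n) ℝ i) :=
      funext (laplacian_apply f)
    rw [e, iteratedFDeriv_neg, Pi.neg_apply, norm_neg, e', iteratedFDeriv_fun_sum_apply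
      (fun i _ => ((h2.clm_apply contDiff_const).clm_apply contDiff_const).contDiffAt)]
    refine (norm_sum_le _ _).trans ?_
    have hb : ∀ i ∈ (Finset.univ : Finset (Fin n)),
        ‖iteratedFDeriv ℝ (2 * k) (fun x => fderiv ℝ (fderiv ℝ f) x
          (EuclideanSpace.basisFun (Fin n) ℝ i) (EuclideanSpace.basisFun (Fin n) ℝ i)) x‖ ≤
        ‖iteratedFDeriv ℝ (2 * (k + 1)) f x‖ := by
      intro i _
      have hv : ‖EuclideanSpace.basisFun (Fin n) ℝ i‖ = 1 := by simp
      have b1 := norm_iteratedFDeriv_clm_apply_const (c := EuclideanSpace.basisFun (Fin n) ℝ i)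
        (h2.clm_apply contDiff_const).contDiffAt (x := x) (n := 2 * k)
        (f := fun x => fderiv ℝ (fderiv ℝ f) x (EuclideanSpace.basisFun (Fin n) ℝ i)) le_rfl
      have b2 := norm_iteratedFDeriv_clm_apply_const (c := EuclideanSpace.basisFun (Fin n) ℝ i)
        h2.contDiffAt (x := x) (n := 2 * k) le_rfl
      rw [hv, one_mul] at b1 b2
      refine (b1.trans b2).trans ?_
      rw [norm_iteratedFDeriv_fderiv, norm_iteratedFDeriv_fderiv]
      exact le_of_eq rfl
    refine (Finset.sum_le_sum hb).trans (by simp)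

lemma negLaplacianPow_add {n : ℕ} (k : ℕ) {f g : Rn n → ℝ}
    (hf : ContDiff ℝ ((2 * k : ℕ) : ℕ∞ω) f) (hg : ContDiff ℝ ((2 * k : ℕ) : ℕ∞ω) g) :
    negLaplacianPow n k (fun x => f x + g x) =
      fun x => negLaplacianPow n k f x + negLaplacianPow n k g x := by
  induction k generalizing f g with
  | zero => rfl
  | succ k ih =>
    simp only [negLaplacianPow_succ]
    have hf2 : ContDiff ℝ 2 f := hf.of_le (by norm_cast; omega)
    have hg2 : ContDiff ℝ 2 g := hg.of_le (by norm_cast; omega)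
    have e : (fun x => -(Laplacian.laplacian (fun x => f x + g x) x)) =
        fun x => -(Laplacian.laplacian f x) + -(Laplacian.laplacian g x) := by
      ext x
      have := ContDiffAt.laplacian_add (hf2.contDiffAt (x := x)) (hg2.contDiffAt (x := x))
      have e : (fun x => f x + g x) = f + g := rfl
      rw [e, this, neg_add]
    rw [e]
    exact ih (contDiff_laplacian (by convert hf using 2; ring)).neg
      (contDiff_laplacian (by convert hg using 2; ring)).neg

/-! ### Cutoffs at the origin and removability of the singularity. -/

lemma contDiff_cutoff_mul {n : ℕ} {m : ℕ} {χ u : Rn n → ℝ} (hχ : ContDiff ℝ m χ)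
    (h0 : χ =ᶠ[𝓝 0] fun _ => 0) (hu : ContDiffOn ℝ m u {x | x ≠ 0}) :
    ContDiff ℝ m (fun x => χ x * u x) := by
  rw [contDiff_iff_contDiffAt]
  intro x
  by_cases hx : x = 0
  · subst hx
    have : (fun x => χ x * u x) =ᶠ[𝓝 0] fun _ => (0 : ℝ) := by
      filter_upwards [h0] with y hy
      simp [hy]
    exact contDiffAt_const.congr_of_eventuallyEq this
  · exact hχ.contDiffAt.mul (hu.contDiffAt (isOpen_ne.mem_nhds hx))

/-- A smooth radial bump: `1` on the closed unit ball, `0` outside the ball of radius `2`. -/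
def unitBump (n : ℕ) : ContDiffBump (0 : Rn n) := ⟨1, 2, one_pos, one_lt_two⟩

lemma unitBump_eq_one {n : ℕ} {x : Rn n} (hx : ‖x‖ ≤ 1) : unitBump n x = 1 :=
  (unitBump n).one_of_mem_closedBall (by simpa [unitBump] using hx)

lemma unitBump_eq_zero {n : ℕ} {x : Rn n} (hx : 2 ≤ ‖x‖) : unitBump n x = 0 :=
  (unitBump n).zero_of_le_dist (by simpa [unitBump] using hx)

lemma contDiff_unitBump_smul {n : ℕ} {m : ℕ∞} (δ : ℝ) :
    ContDiff ℝ m (fun x : Rn n => unitBump n (δ⁻¹ • x)) :=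
  (unitBump n).contDiff.comp (contDiff_const_smul _)

lemma unitBump_smul_eventuallyEq_one {n : ℕ} {δ : ℝ} (hδ : 0 < δ) :
    (fun x : Rn n => unitBump n (δ⁻¹ • x)) =ᶠ[𝓝 0] fun _ => 1 := by
  filter_upwards [closedBall_mem_nhds (0 : Rn n) hδ] with x hx
  apply unitBump_eq_one
  rw [norm_smul, norm_inv, Real.norm_of_nonneg hδ.le, inv_mul_le_iff₀ hδ]
  simpa using hx

lemma unitBump_smul_eq_zero {n : ℕ} {δ : ℝ} (hδ : 0 < δ) {x : Rn n} (hx : 2 * δ ≤ ‖x‖) :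
    unitBump n (δ⁻¹ • x) = 0 := by
  apply unitBump_eq_zero
  rw [norm_smul, norm_inv, Real.norm_of_nonneg hδ.le, le_inv_mul_iff₀ hδ]
  linarith

/-- If `ψ` vanishes near the origin, then on its support `u` may be replaced by `χ u`. When `u` is
`C^{2k}` off the origin, `χ u` is `C^{2k}` everywhere, and the global integration by parts applies.
-/
lemma negLaplacianPow_mul_eqOn {n k : ℕ} {u ψ : Rn n → ℝ} (h0 : (0 : Rn n) ∉ tsupport ψ) :
    ∃ χ : Rn n → ℝ, ContDiff ℝ ((2 * k : ℕ) : ℕ∞ω) χ ∧ (χ =ᶠ[𝓝 0] fun _ => 0) ∧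
      ∀ x ∈ tsupport ψ, negLaplacianPow n k u x = negLaplacianPow n k (fun y => χ y * u y) x ∧
        χ x = 1 := by
  obtain ⟨r, hr, hrs⟩ := Metric.isOpen_iff.mp (isClosed_tsupport ψ).isOpen_compl 0 h0
  -- The bump at scale `r/4` vanishes for `‖x‖ ≥ r/2`, while the support of `ψ` stays at distance at
  -- least `r`; so `χ = 1` on a whole neighbourhood of each point of that support.
  have hδ : 0 < r / 4 := by linarith
  refine ⟨fun x => 1 - unitBump n ((r / 4)⁻¹ • x),
    contDiff_const.sub (contDiff_unitBump_smul (m := ((2 * k : ℕ) : ℕ∞)) _), ?_, fun x hx => ?_⟩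
  · filter_upwards [unitBump_smul_eventuallyEq_one hδ] with x hx
    rw [hx, sub_self]
  · have hxr : r ≤ ‖x‖ := by
      by_contra hlt
      exact hrs (by simpa using hlt) hx
    have hev : ∀ᶠ y in 𝓝 x, r / 2 < ‖y‖ :=
      continuous_norm.continuousAt.eventually (lt_mem_nhds (by linarith))
    refine ⟨(negLaplacianPow_congr k ?_).eq_of_nhds, ?_⟩
    · filter_upwards [hev] with y hy
      rw [unitBump_smul_eq_zero hδ (by linarith), sub_zero, one_mul]
    · change 1 - unitBump n ((r / 4)⁻¹ • x) = 1
      rw [unitBump_smul_eq_zero hδ (by linarith), sub_zero]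

lemma continuousOn_negLaplacianPow {n k : ℕ} {u : Rn n → ℝ}
    (hu : ContDiffOn ℝ ((2 * k : ℕ) : ℕ∞ω) u {x | x ≠ 0}) :
    ContinuousOn (negLaplacianPow n k u) {x | x ≠ 0} := by
  intro x hx
  apply ContinuousAt.continuousWithinAt
  have hx0 : 0 < ‖x‖ / 4 := by have := norm_pos_iff.mpr hx; linarith
  have hc : Continuous (negLaplacianPow n k
      (fun y => (1 - unitBump n ((‖x‖ / 4)⁻¹ • y)) * u y)) := by
    apply continuous_negLaplacianPow
    apply contDiff_cutoff_mul
      (contDiff_const.sub (contDiff_unitBump_smul (m := ((2 * k : ℕ) : ℕ∞)) _)) _ hu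
    filter_upwards [unitBump_smul_eventuallyEq_one hx0] with x hx
    rw [hx, sub_self]
  refine hc.continuousAt.congr (negLaplacianPow_congr k ?_)
  have hev : ∀ᶠ y in 𝓝 x, ‖x‖ / 2 < ‖y‖ :=
      continuous_norm.continuousAt.eventually (lt_mem_nhds (by linarith))
  filter_upwards [hev] with y hy
  rw [unitBump_smul_eq_zero hx0 (by linarith), sub_zero, one_mul]

lemma integral_mul_negLaplacianPow_of_zero_notMem_tsupport {n k : ℕ} {u ψ : Rn n → ℝ}
    (hu : ContDiffOn ℝ ((2 * k : ℕ) : ℕ∞ω) u {x | x ≠ 0})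
    (hψ : ContDiff ℝ ((2 * k : ℕ) : ℕ∞ω) ψ) (hc : HasCompactSupport ψ)
    (h0 : (0 : Rn n) ∉ tsupport ψ) :
    Integrable (fun x => negLaplacianPow n k u x * ψ x) ∧
      ∫ x, u x * negLaplacianPow n k ψ x = ∫ x, negLaplacianPow n k u x * ψ x := by
  obtain ⟨χ, hχ, hχ0, hχ1⟩ := negLaplacianPow_mul_eqOn (k := k) (u := u) h0
  have hχu := contDiff_cutoff_mul hχ hχ0 hu
  have e1 : (fun x => negLaplacianPow n k u x * ψ x) =
      fun x => negLaplacianPow n k (fun y => χ y * u y) x * ψ x := by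
    ext x
    by_cases hx : x ∈ tsupport ψ
    · rw [(hχ1 x hx).1]
    · rw [image_eq_zero_of_notMem_tsupport hx, mul_zero, mul_zero]
  have e2 : (fun x => u x * negLaplacianPow n k ψ x) =
      fun x => (χ x * u x) * negLaplacianPow n k ψ x := by
    ext x
    by_cases hx : x ∈ tsupport ψ
    · rw [(hχ1 x hx).2, one_mul]
    · rw [image_eq_zero_of_notMem_tsupport (fun h => hx (tsupport_negLaplacianPow_subset k ψ h)),
        mul_zero, mul_zero]
  rw [e1, e2]
  exact ⟨((continuous_negLaplacianPow hχu).mul hψ.continuous).integrable_of_hasCompactSupport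
    hc.mul_left, integral_mul_negLaplacianPow k hχu hψ hc⟩

lemma exists_bound_iteratedFDeriv {n N : ℕ} {ψ : Rn n → ℝ} (hψ : ContDiff ℝ N ψ)
    (hc : HasCompactSupport ψ) : ∃ M : ℝ, 0 ≤ M ∧ ∀ i ≤ N, ∀ x, ‖iteratedFDeriv ℝ i ψ x‖ ≤ M := by
  have h : ∀ i : Fin (N + 1), ∃ M : ℝ, ∀ x, ‖iteratedFDeriv ℝ i ψ x‖ ≤ M := fun i =>
    (hψ.continuous_iteratedFDeriv
      (by exact_mod_cast Nat.lt_succ_iff.mp i.2)).bounded_above_of_compact_support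
      (hc.iteratedFDeriv i)
  choose M hM using h
  refine ⟨∑ i, |M i|, by positivity, fun i hi x => ?_⟩
  refine (hM ⟨i, Nat.lt_succ_of_le hi⟩ x).trans ((le_abs_self _).trans ?_)
  exact Finset.single_le_sum (f := fun i => |M i|) (fun _ _ => abs_nonneg _) (Finset.mem_univ _)

/-- In Leibniz's rule each derivative that falls on the bump costs one factor `δ⁻¹`; for `δ ≤ 1` the
worst term has all `2k` of them there. -/
lemma negLaplacianPow_mul_unitBump_le {n k : ℕ} {ψ : Rn n → ℝ}
    (hψ : ContDiff ℝ ((2 * k : ℕ) : ℕ∞ω) ψ) (hc : HasCompactSupport ψ) :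
    ∃ C : ℝ, 0 ≤ C ∧ ∀ δ : ℝ, 0 < δ → δ ≤ 1 → ∀ x,
      |negLaplacianPow n k (fun y => ψ y * unitBump n (δ⁻¹ • y)) x| ≤ C * (δ⁻¹) ^ (2 * k) := by
  obtain ⟨C, hC, hCb⟩ := norm_negLaplacianPow_le (n := n) k
  obtain ⟨M, hM, hMb⟩ := exists_bound_iteratedFDeriv hψ hc
  have hb : ContDiff ℝ ((2 * k : ℕ) : ℕ∞ω) (unitBump n) :=
    (unitBump n).contDiff (n := ((2 * k : ℕ) : ℕ∞))
  obtain ⟨N, hN, hNb⟩ := exists_bound_iteratedFDeriv hb (unitBump n).hasCompactSupport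
  refine ⟨C * ∑ i ∈ Finset.range (2 * k + 1), ((2 * k).choose i : ℝ) * M * N, by positivity,
    fun δ hδ hδ1 x => ?_⟩
  have hbδ : ContDiff ℝ ((2 * k : ℕ) : ℕ∞ω) (fun x : Rn n => unitBump n (δ⁻¹ • x)) :=
    contDiff_unitBump_smul (m := ((2 * k : ℕ) : ℕ∞)) _
  refine (hCb _ (hψ.mul hbδ) x).trans ?_
  rw [mul_assoc]
  gcongr
  refine (norm_iteratedFDeriv_mul_le hψ hbδ x le_rfl).trans ?_
  rw [Finset.sum_mul]
  refine Finset.sum_le_sum fun i hi => ?_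
  have hi' : i ≤ 2 * k := Nat.lt_succ_iff.mp (Finset.mem_range.mp hi)
  have h1 : 1 ≤ δ⁻¹ := (one_le_inv₀ hδ).mpr hδ1
  rw [iteratedFDeriv_comp_const_smul _ (hb.of_le (by norm_cast; omega)), norm_smul, norm_pow,
    Real.norm_of_nonneg (by positivity)]
  have h2 : (δ⁻¹) ^ (2 * k - i) ≤ (δ⁻¹) ^ (2 * k) := pow_le_pow_right₀ h1 (by omega)
  have h3 := hMb i hi' x
  have h4 := hNb (2 * k - i) (by omega) (δ⁻¹ • x)
  calc _ ≤ ((2 * k).choose i : ℝ) * M * ((δ⁻¹) ^ (2 * k) * N) := by gcongr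
    _ = _ := by ring

/-- The integrand is of size `δ^(-2k)` on a ball of volume of order `δ^n`, so the integral is
`O(δ^(n-2k))`. This is where a subcritical order `2k < n` makes the origin removable. -/
lemma tendsto_integral_negLaplacianPow_mul_unitBump {n k : ℕ} (hkn : 2 * k < n) {u ψ : Rn n → ℝ}
    (hu : Continuous u) (hψ : ContDiff ℝ ((2 * k : ℕ) : ℕ∞ω) ψ) (hc : HasCompactSupport ψ) :
    Tendsto (fun δ : ℝ => ∫ x, u x * negLaplacianPow n k (fun y => ψ y * unitBump n (δ⁻¹ • y)) x)
      (𝓝[>] 0) (𝓝 0) := by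
  obtain ⟨C, hC, hCb⟩ := negLaplacianPow_mul_unitBump_le hψ hc
  obtain ⟨M, hM⟩ := (isCompact_closedBall (0 : Rn n) 2).exists_bound_of_continuousOn hu.continuousOn
  have hM0 : 0 ≤ M := (norm_nonneg _).trans (hM 0 (by simp))
  set V := (volume : Measure (Rn n)).real (ball 0 1)
  have hlim : Tendsto (fun δ : ℝ => M * C * 2 ^ n * V * δ ^ (n - 2 * k)) (𝓝[>] 0) (𝓝 0) := by
    have : Tendsto (fun δ : ℝ => M * C * 2 ^ n * V * δ ^ (n - 2 * k)) (𝓝 0)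
        (𝓝 (M * C * 2 ^ n * V * 0 ^ (n - 2 * k))) := by
      apply Continuous.tendsto; fun_prop
    rw [zero_pow (by omega), mul_zero] at this
    exact this.mono_left nhdsWithin_le_nhds
  refine squeeze_zero_norm' ?_ hlim
  filter_upwards [Ioc_mem_nhdsGT (zero_lt_one' ℝ)] with δ hδ
  have hδ0 : 0 < δ := hδ.1
  have hsupp : ∀ x, x ∉ closedBall (0 : Rn n) (2 * δ) →
      u x * negLaplacianPow n k (fun y => ψ y * unitBump n (δ⁻¹ • y)) x = 0 := by
    intro x hx
    rw [mem_closedBall_zero_iff, not_le] at hx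
    have : (fun y => ψ y * unitBump n (δ⁻¹ • y)) =ᶠ[𝓝 x] fun _ => 0 := by
      filter_upwards [continuous_norm.continuousAt.eventually (lt_mem_nhds hx)] with y hy
      rw [unitBump_smul_eq_zero hδ0 hy.le, mul_zero]
    rw [(negLaplacianPow_congr k this).eq_of_nhds, negLaplacianPow_fun_zero, mul_zero]
  rw [← setIntegral_eq_integral_of_forall_compl_eq_zero hsupp]
  refine (norm_setIntegral_le_of_norm_le_const (C := M * (C * (δ⁻¹) ^ (2 * k)))
    measure_closedBall_lt_top ?_).trans ?_
  · intro x hx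
    rw [norm_mul]
    gcongr
    · exact hM x (closedBall_subset_closedBall (by linarith [hδ.2]) hx)
    · exact hCb δ hδ0 hδ.2 x
  · rw [Measure.addHaar_real_closedBall _ _ (by positivity)]
    rw [finrank_euclideanSpace_fin, mul_pow]
    have : δ ^ n = δ ^ (2 * k) * δ ^ (n - 2 * k) := by rw [← pow_add]; congr 1; omega
    rw [this, inv_pow]
    apply le_of_eq
    field_simp
    rfl

/-- If `u` is continuous and `(-Δ)^k u = h ≥ 0` classically away from the origin, then the
equation holds on all of `ℝⁿ` in the sense of distributions, because `2k < n`. -/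
lemma integral_mul_negLaplacianPow_of_nonneg {n k : ℕ} (hkn : 2 * k < n) {u h ψ : Rn n → ℝ}
    (huc : Continuous u) (hu : ContDiffOn ℝ ((2 * k : ℕ) : ℕ∞ω) u {x | x ≠ 0})
    (hh : ∀ x, x ≠ 0 → negLaplacianPow n k u x = h x) (hpos : ∀ x, x ≠ 0 → 0 ≤ h x)
    (hψ : ContDiff ℝ ((2 * k : ℕ) : ℕ∞ω) ψ) (hc : HasCompactSupport ψ) (hψ0 : ∀ x, 0 ≤ ψ x) :
    Integrable (fun x => h x * ψ x) ∧
      ∫ x, u x * negLaplacianPow n k ψ x = ∫ x, h x * ψ x := by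
  have : Nontrivial (Rn n) := by
    have : Nonempty (Fin n) := ⟨⟨0, by omega⟩⟩
    infer_instance
  let δ : ℕ → ℝ := fun j => 1 / ((j : ℝ) + 1)
  have hδ0 : ∀ j, 0 < δ j := fun j => by positivity
  have hδl : Tendsto δ atTop (𝓝[>] 0) :=
    tendsto_nhdsWithin_iff.mpr ⟨tendsto_one_div_add_atTop_nhds_zero_nat,
      Eventually.of_forall hδ0⟩
  let b : ℕ → Rn n → ℝ := fun j y => unitBump n ((δ j)⁻¹ • y)
  have hbc : ∀ j, ContDiff ℝ ((2 * k : ℕ) : ℕ∞ω) (b j) := fun j =>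
    contDiff_unitBump_smul (m := ((2 * k : ℕ) : ℕ∞)) _
  have hb0 : ∀ j y, 0 ≤ 1 - b j y := fun j y => sub_nonneg.mpr (unitBump n).le_one
  have hb1 : ∀ j y, 1 - b j y ≤ 1 := fun j y => by
    have : 0 ≤ b j y := (unitBump n).nonneg' _
    linarith
  have hη : ∀ j, ContDiff ℝ ((2 * k : ℕ) : ℕ∞ω) (fun y => ψ y * (1 - b j y)) := fun j =>
    hψ.mul (contDiff_const.sub (hbc j))
  have hη0 : ∀ j, (0 : Rn n) ∉ tsupport (fun y => ψ y * (1 - b j y)) := by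
    intro j
    rw [notMem_tsupport_iff_eventuallyEq]
    filter_upwards [unitBump_smul_eventuallyEq_one (n := n) (hδ0 j)] with y hy
    simp [b, hy]
  have hloc := fun j => integral_mul_negLaplacianPow_of_zero_notMem_tsupport hu (hη j)
    hc.mul_right (hη0 j)
  have haeh : ∀ᵐ x : Rn n, x ≠ 0 := by simp [ae_iff, measure_singleton]
  have hae : ∀ ψ' : Rn n → ℝ, (fun x => negLaplacianPow n k u x * ψ' x) =ᵐ[volume]
      fun x => h x * ψ' x := by
    intro ψ'
    filter_upwards [haeh] with x hx
    rw [hh x hx]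
  have hint : ∀ j, Integrable (fun x => h x * (ψ x * (1 - b j x))) := fun j =>
    (hloc j).1.congr (hae _)
  -- Split `ψ = ψ (1 - b) + ψ b`: the first part vanishes near the origin and can be integrated by
  -- parts, the second contributes an error that tends to zero.
  have heq : ∀ j, ∫ x, h x * (ψ x * (1 - b j x)) =
      (∫ x, u x * negLaplacianPow n k ψ x) - ∫ x, u x * negLaplacianPow n k
        (fun y => ψ y * b j y) x := by
    intro j
    rw [← integral_congr_ae (hae _), ← (hloc j).2, ← integral_sub]
    · congr 1
      ext x
      have e := negLaplacianPow_add k (hη j) (hψ.mul (hbc j))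
      have e2 : (fun x => ψ x * (1 - b j x) + ψ x * b j x) = ψ := by ext x; ring
      rw [e2] at e
      rw [e]
      ring
    · exact (huc.mul (continuous_negLaplacianPow hψ)).integrable_of_hasCompactSupport
        (hc.negLaplacianPow k).mul_left
    · exact (huc.mul (continuous_negLaplacianPow (hψ.mul (hbc j)))).integrable_of_hasCompactSupport
        (HasCompactSupport.negLaplacianPow k hc.mul_right).mul_left
  have hlim : Tendsto (fun j => ∫ x, h x * (ψ x * (1 - b j x))) atTop
      (𝓝 (∫ x, u x * negLaplacianPow n k ψ x)) := by
    simp only [heq]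
    have := (tendsto_integral_negLaplacianPow_mul_unitBump hkn huc hψ hc).comp hδl
    simpa using tendsto_const_nhds.sub this
  have hpt : ∀ x, x ≠ 0 → Tendsto (fun j => h x * (ψ x * (1 - b j x))) atTop (𝓝 (h x * ψ x)) := by
    intro x hx
    have hev : ∀ᶠ j in atTop, h x * (ψ x * (1 - b j x)) = h x * ψ x := by
      have h2 : ∀ᶠ j in atTop, δ j < ‖x‖ / 2 :=
        (tendsto_nhdsWithin_iff.mp hδl).1.eventually
          (gt_mem_nhds (by have := norm_pos_iff.mpr hx; linarith))
      filter_upwards [h2] with j hj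
      have : b j x = 0 := unitBump_smul_eq_zero (hδ0 j) (by linarith)
      rw [this, sub_zero, mul_one]
    exact tendsto_const_nhds.congr' (hev.mono fun j hj => hj.symm)
  have hmeas : AEStronglyMeasurable (fun x => h x * ψ x) volume :=
    aestronglyMeasurable_of_tendsto_ae atTop (fun j => (hint j).1) (haeh.mono hpt)
  have hI : Integrable (fun x => h x * ψ x) := by
    refine ⟨hmeas, ?_⟩
    -- Nothing is known a priori about the integrability of `h` at the origin. Fatou's lemma
    -- supplies it, because the integrals with the origin cut out converge to a finite limit and
    -- their integrands are nonnegative.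
    have hfatou : ∫⁻ x, ‖h x * ψ x‖ₑ ≤
        liminf (fun j => ∫⁻ x, ‖h x * (ψ x * (1 - b j x))‖ₑ) atTop := by
      refine le_trans (le_of_eq (lintegral_congr_ae ?_))
        (lintegral_liminf_le' fun j => (hint j).1.aemeasurable.enorm)
      filter_upwards [haeh] with x hx
      exact (((continuous_enorm.tendsto _).comp (hpt x hx)).liminf_eq).symm
    refine lt_of_le_of_lt hfatou ?_
    have hconv : Tendsto (fun j => ∫⁻ x, ‖h x * (ψ x * (1 - b j x))‖ₑ) atTop
        (𝓝 (ENNReal.ofReal (∫ x, u x * negLaplacianPow n k ψ x))) := by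
      refine (ENNReal.tendsto_ofReal hlim).congr fun j => ?_
      rw [ofReal_integral_eq_lintegral_ofReal (hint j)]
      · refine lintegral_congr_ae ?_
        filter_upwards [haeh] with x hx
        rw [Real.enorm_of_nonneg (mul_nonneg (hpos x hx) (mul_nonneg (hψ0 x) (hb0 j x)))]
      · filter_upwards [haeh] with x hx
        exact mul_nonneg (hpos x hx) (mul_nonneg (hψ0 x) (hb0 j x))
    rw [hconv.liminf_eq]
    exact ENNReal.ofReal_lt_top
  refine ⟨hI, tendsto_nhds_unique hlim ?_⟩
  refine tendsto_integral_of_dominated_convergence _ (fun j => (hint j).1) hI (fun j => ?_)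
    (haeh.mono hpt)
  filter_upwards [haeh] with x hx
  rw [Real.norm_of_nonneg (mul_nonneg (hpos x hx) (mul_nonneg (hψ0 x) (hb0 j x)))]
  exact mul_le_mul_of_nonneg_left (mul_le_of_le_one_right (hψ0 x) (hb1 j x)) (hpos x hx)

/-! ### Radial calculus: the Laplacian on functions of `s |y - x₀|² + e`. -/

/-- The quadratic function `s |y - x₀|² + e`. -/
def radialQuad {n : ℕ} (s e : ℝ) (x₀ y : Rn n) : ℝ := s * ‖y - x₀‖ ^ 2 + e

/-- The operator on functions of one variable that corresponds to `-Δ / s` on functions of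
`s |y - x₀|² + e`. -/
def negRadialLaplacian (n : ℕ) (e : ℝ) (g : ℝ → ℝ) : ℝ → ℝ :=
  fun t => -(4 * (t - e) * deriv (deriv g) t + 2 * n * deriv g t)

lemma hasFDerivAt_radialQuad {n : ℕ} (s e : ℝ) (x₀ y : Rn n) :
    HasFDerivAt (radialQuad s e x₀) ((2 * s) • innerSL ℝ (y - x₀)) y := by
  have h1 : HasFDerivAt (fun y : Rn n => y - x₀) (ContinuousLinearMap.id ℝ (Rn n)) y :=
    (hasFDerivAt_id y).sub_const x₀
  have h2 := (h1.norm_sq.const_mul s).add_const e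
  refine h2.congr_fderiv ?_
  ext v
  simp
  ring

lemma continuous_radialQuad {n : ℕ} (s e : ℝ) (x₀ : Rn n) : Continuous (radialQuad s e x₀) := by
  unfold radialQuad; fun_prop

lemma contDiff_radialQuad {n : ℕ} {m : ℕ∞ω} (s e : ℝ) (x₀ : Rn n) :
    ContDiff ℝ m (radialQuad s e x₀) := by
  unfold radialQuad
  exact (contDiff_const.mul ((contDiff_id.sub contDiff_const).norm_sq ℝ)).add contDiff_const

/-- For `q = s |y - x₀|² + e` one has `|∇q|² = 4 s (q - e)` and `Δq = 2 s n`; this is the chain rule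
`Δ(g ∘ q) = g'' |∇q|² + g' Δq`. The variable `q` avoids square roots, so there is no singularity at
`x₀`. -/
lemma laplacian_comp_radialQuad {n : ℕ} {s e : ℝ} {x₀ y : Rn n} {g g1 : ℝ → ℝ} {g2 : ℝ}
    (h1 : ∀ᶠ t in 𝓝 (radialQuad s e x₀ y), HasDerivAt g (g1 t) t)
    (h2 : HasDerivAt g1 g2 (radialQuad s e x₀ y)) :
    Laplacian.laplacian (fun z => g (radialQuad s e x₀ z)) y =
      s * (4 * (radialQuad s e x₀ y - e) * g2 + 2 * n * g1 (radialQuad s e x₀ y)) := by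
  have hev : fderiv ℝ (fun z => g (radialQuad s e x₀ z)) =ᶠ[𝓝 y]
      fun z => g1 (radialQuad s e x₀ z) • ((2 * s) • innerSL ℝ (z - x₀)) := by
    filter_upwards [(continuous_radialQuad s e x₀).continuousAt.eventually h1] with z hz
    exact (hz.comp_hasFDerivAt z (hasFDerivAt_radialQuad s e x₀ z)).fderiv
  have hg1 : HasFDerivAt (fun z => g1 (radialQuad s e x₀ z))
      (g2 • ((2 * s) • innerSL ℝ (y - x₀))) y :=
    h2.comp_hasFDerivAt y (hasFDerivAt_radialQuad s e x₀ y)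
  have hin : HasFDerivAt (fun z : Rn n => (2 * s) • innerSL ℝ (z - x₀))
      ((2 * s) • (innerSL ℝ : Rn n →L[ℝ] Rn n →L[ℝ] ℝ)) y := by
    have h3 : HasFDerivAt (fun z : Rn n => innerSL ℝ (z - x₀))
        (innerSL ℝ : Rn n →L[ℝ] Rn n →L[ℝ] ℝ) y := by
      have h4 := (((innerSL ℝ : Rn n →L[ℝ] Rn n →L[ℝ] ℝ).hasFDerivAt (x := y - x₀)).comp
        (f := fun y => y - x₀) y ((hasFDerivAt_id y).sub_const x₀))
      exact h4
    exact h3.const_smul (2 * s)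
  have hfd := (hg1.smul hin).fderiv
  rw [laplacian_apply, hev.fderiv_eq]
  have hterm : ∀ i, fderiv ℝ (fun z => g1 (radialQuad s e x₀ z) • ((2 * s) • innerSL ℝ (z - x₀))) y
      (EuclideanSpace.basisFun (Fin n) ℝ i) (EuclideanSpace.basisFun (Fin n) ℝ i) =
      4 * s ^ 2 * g2 * ((y - x₀) i) ^ 2 + 2 * s * g1 (radialQuad s e x₀ y) := by
    intro i
    have e1 : (fun z => g1 (radialQuad s e x₀ z) • ((2 * s) • innerSL ℝ (z - x₀))) =
      ((fun z => g1 (radialQuad s e x₀ z)) • fun z : Rn n => (2 * s) • innerSL ℝ (z - x₀)) := rfl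
    have hv : innerSL ℝ (EuclideanSpace.single i 1 : Rn n) (EuclideanSpace.single i 1) =
        (1 : ℝ) := by
      change inner ℝ (EuclideanSpace.single i 1 : Rn n) (EuclideanSpace.single i 1) = (1 : ℝ)
      simp
    rw [e1, hfd]
    simp [hv, EuclideanSpace.inner_single_right]
    ring
  rw [Finset.sum_congr rfl fun i _ => hterm i, Finset.sum_add_distrib, ← Finset.mul_sum]
  have hn : ∑ i, ((y - x₀) i) ^ 2 = ‖y - x₀‖ ^ 2 := (EuclideanSpace.real_norm_sq_eq _).symm
  rw [hn]
  simp [radialQuad]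
  ring

lemma contDiffOn_negRadialLaplacian {n m : ℕ} {e : ℝ} {U : Set ℝ} (hU : IsOpen U) {g : ℝ → ℝ}
    (hg : ContDiffOn ℝ ((m + 2 : ℕ) : ℕ∞ω) g U) :
    ContDiffOn ℝ m (negRadialLaplacian n e g) U := by
  have h1 : ContDiffOn ℝ ((m + 1 : ℕ) : ℕ∞ω) (deriv g) U :=
    hg.deriv_of_isOpen hU (by norm_cast)
  have h2 : ContDiffOn ℝ m (deriv (deriv g)) U := h1.deriv_of_isOpen hU (by norm_cast)
  have h3 : ContDiffOn ℝ m (deriv g) U := h1.of_le (by norm_cast; omega)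
  unfold negRadialLaplacian
  fun_prop

lemma contDiffOn_iterate_negRadialLaplacian {n m : ℕ} (k : ℕ) {e : ℝ} {U : Set ℝ} (hU : IsOpen U)
    {g : ℝ → ℝ} (hg : ContDiffOn ℝ ((m + 2 * k : ℕ) : ℕ∞ω) g U) :
    ContDiffOn ℝ m ((negRadialLaplacian n e)^[k] g) U := by
  induction k generalizing g with
  | zero => simpa using hg
  | succ k ih =>
    rw [Function.iterate_succ_apply]
    exact ih (contDiffOn_negRadialLaplacian (m := m + 2 * k) hU (by convert hg using 2; ring))

lemma eqOn_negRadialLaplacian {n : ℕ} {e : ℝ} {U : Set ℝ} (hU : IsOpen U) {g g' : ℝ → ℝ}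
    (h : Set.EqOn g g' U) : Set.EqOn (negRadialLaplacian n e g) (negRadialLaplacian n e g') U := by
  intro t ht
  have h1 := h.deriv hU
  have h2 := h1.deriv hU
  simp only [negRadialLaplacian]
  rw [h1 ht, h2 ht]

lemma eqOn_iterate_negRadialLaplacian {n : ℕ} (k : ℕ) {e : ℝ} {U : Set ℝ} (hU : IsOpen U)
    {g g' : ℝ → ℝ} (h : Set.EqOn g g' U) :
    Set.EqOn ((negRadialLaplacian n e)^[k] g) ((negRadialLaplacian n e)^[k] g') U := by
  induction k with
  | zero => exact h
  | succ k ih =>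
    rw [Function.iterate_succ_apply', Function.iterate_succ_apply']
    exact eqOn_negRadialLaplacian hU ih

lemma negLaplacianPow_comp_radialQuad {n : ℕ} (k : ℕ) {s e : ℝ} {x₀ : Rn n} {U : Set ℝ}
    (hU : IsOpen U) (hq : ∀ y, radialQuad s e x₀ y ∈ U) {g : ℝ → ℝ}
    (hg : ContDiffOn ℝ ((2 * k : ℕ) : ℕ∞ω) g U) :
    negLaplacianPow n k (fun y => g (radialQuad s e x₀ y)) =
      fun y => s ^ k * ((negRadialLaplacian n e)^[k] g) (radialQuad s e x₀ y) := by
  induction k with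
  | zero => simp [negLaplacianPow_zero]
  | succ k ih =>
    rw [negLaplacianPow_succ', ih (hg.of_le (by norm_cast; omega)), Function.iterate_succ_apply']
    ext y
    set G := (negRadialLaplacian n e)^[k] g
    have hG : ContDiffOn ℝ ((2 : ℕ) : ℕ∞ω) G U :=
      contDiffOn_iterate_negRadialLaplacian (m := 2) k hU
      (by convert hg using 2; ring)
    have hG1 : ContDiffOn ℝ ((1 : ℕ) : ℕ∞ω) (deriv G) U := hG.deriv_of_isOpen hU (by norm_cast)
    have hd1 : ∀ t ∈ U, HasDerivAt G (deriv G t) t := fun t ht =>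
      ((hG.differentiableOn (by norm_num)).differentiableAt (hU.mem_nhds ht)).hasDerivAt
    have hd2 : ∀ t ∈ U, HasDerivAt (deriv G) (deriv (deriv G) t) t := fun t ht =>
      ((hG1.differentiableOn (by norm_num)).differentiableAt (hU.mem_nhds ht)).hasDerivAt
    rw [laplacian_comp_radialQuad (g := fun t => s ^ k * G t) (g1 := fun t => s ^ k * deriv G t)
      (g2 := s ^ k * deriv (deriv G) (radialQuad s e x₀ y))]
    · simp only [negRadialLaplacian]
      ring
    · filter_upwards [hU.mem_nhds (hq y)] with t ht
      exact (hd1 t ht).const_mul _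
    · exact (hd2 _ (hq y)).const_mul _

/-! ### Explicit iterates on powers: the equation of the bubble. -/

lemma deriv_rpow_neg_eqOn (b : ℝ) :
    Set.EqOn (deriv fun t : ℝ => t ^ (-b)) (fun t => -b * t ^ (-(b + 1))) (Set.Ioi 0) := by
  intro t ht
  have := (Real.hasDerivAt_rpow_const (x := t) (p := -b) (Or.inl (ne_of_gt ht))).deriv
  simp only
  rw [this]
  ring_nf

lemma contDiffOn_rpow_neg (m : ℕ∞ω) (b : ℝ) :
    ContDiffOn ℝ m (fun t : ℝ => t ^ (-b)) (Set.Ioi 0) := fun _ ht =>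
  (Real.contDiffAt_rpow_const_of_ne (p := -b) (ne_of_gt ht)).contDiffWithinAt

lemma negRadialLaplacian_sum {n : ℕ} {e : ℝ} {U : Set ℝ} (hU : IsOpen U) (s : Finset ℕ)
    (c : ℕ → ℝ) (g : ℕ → ℝ → ℝ) (hg : ∀ i, ContDiffOn ℝ 2 (g i) U) :
    Set.EqOn (negRadialLaplacian n e (fun t => ∑ i ∈ s, c i * g i t))
      (fun t => ∑ i ∈ s, c i * negRadialLaplacian n e (g i) t) U := by
  have hd : ∀ i, ∀ t ∈ U, DifferentiableAt ℝ (g i) t := fun i t ht =>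
    ((hg i).differentiableOn (by norm_num)).differentiableAt (hU.mem_nhds ht)
  have hd' : ∀ i, ∀ t ∈ U, DifferentiableAt ℝ (deriv (g i)) t := fun i t ht =>
    (((hg i).deriv_of_isOpen (m := 1) hU (by norm_num)).differentiableOn
      (by norm_num)).differentiableAt (hU.mem_nhds ht)
  have h1 : Set.EqOn (deriv (fun t => ∑ i ∈ s, c i * g i t))
      (fun t => ∑ i ∈ s, c i * deriv (g i) t) U := by
    intro t ht
    rw [deriv_fun_sum fun i _ => (hd i t ht).const_mul (c i)]
    exact Finset.sum_congr rfl fun i _ => deriv_const_mul _ (hd i t ht)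
  have h2 : Set.EqOn (deriv (deriv (fun t => ∑ i ∈ s, c i * g i t)))
      (fun t => ∑ i ∈ s, c i * deriv (deriv (g i)) t) U := by
    intro t ht
    rw [h1.deriv hU ht, deriv_fun_sum fun i _ => (hd' i t ht).const_mul (c i)]
    exact Finset.sum_congr rfl fun i _ => deriv_const_mul _ (hd' i t ht)
  intro t ht
  simp only [negRadialLaplacian]
  rw [h1 ht, h2 ht, Finset.mul_sum, Finset.mul_sum, ← Finset.sum_add_distrib,
    ← Finset.sum_neg_distrib]
  exact Finset.sum_congr rfl fun i _ => by ring

lemma negRadialLaplacian_rpow_neg {n : ℕ} {e : ℝ} (b : ℝ) {t : ℝ} (ht : 0 < t) :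
    negRadialLaplacian n e (fun t => t ^ (-b)) t =
      2 * b * (n - 2 * b - 2) * t ^ (-(b + 1)) + 4 * e * (b * (b + 1)) * t ^ (-(b + 2)) := by
  have h1 := deriv_rpow_neg_eqOn b
  have h2 : deriv (deriv fun t : ℝ => t ^ (-b)) t = -b * (-(b + 1) * t ^ (-(b + 1 + 1))) := by
    rw [h1.deriv isOpen_Ioi ht, deriv_const_mul]
    · rw [deriv_rpow_neg_eqOn (b + 1) ht]
    · exact (Real.hasDerivAt_rpow_const (Or.inl ht.ne')).differentiableAt
  have h3 : t ^ (-(b + 1)) = t * t ^ (-(b + 2)) := by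
    rw [show -(b + 1) = 1 + -(b + 2) by ring, Real.rpow_add ht, Real.rpow_one]
  simp only [negRadialLaplacian]
  rw [h2, h1 ht]
  simp only
  rw [h3]
  have h4 : (-(b + 1 + 1)) = -(b + 2) := by ring
  rw [h4]
  ring

/-- Coefficients in the iterated Laplacian of a power of `|x|² + e`. -/
def bubbleCoeff (k j i : ℕ) : ℝ :=
  (j.choose i : ℝ) * ∏ l ∈ Finset.Ico (i + 1) (j + 1), ((k : ℝ) - l)

lemma bubbleCoeff_succ_zero (k j : ℕ) :
    bubbleCoeff k (j + 1) 0 = (k - 1 - j) * bubbleCoeff k j 0 := by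
  simp only [bubbleCoeff]
  rw [Finset.prod_Ico_succ_top (by omega)]
  push_cast
  simp
  ring

/-- The recursion that one application of the radial operator imposes on the coefficients; it
reduces to Pascal's rule and `C(j, i+1) (i+1) = C(j, i) (j-i)`. -/
lemma bubbleCoeff_succ_succ (k j i : ℕ) :
    bubbleCoeff k (j + 1) (i + 1) =
      (k - 1 - j - (i + 1)) * bubbleCoeff k j (i + 1) + bubbleCoeff k j i := by
  simp only [bubbleCoeff]
  rcases lt_trichotomy i j with h | h | h
  · rw [Finset.prod_Ico_succ_top (by omega) (b := j + 1),
      Finset.prod_eq_prod_Ico_succ_bot (by omega : i + 1 < j + 1)]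
    have h1 : ((j.choose (i + 1) : ℕ) : ℝ) * (i + 1) = j.choose i * (j - i) := by
      have := Nat.choose_succ_right_eq j i
      rw [← Nat.cast_sub h.le]
      exact_mod_cast this
    rw [Nat.choose_succ_succ]
    push_cast
    generalize ∏ l ∈ Finset.Ico (i + 1 + 1) (j + 1), ((k : ℝ) - l) = P
    linear_combination P * h1
  · subst h
    simp
  · rw [Nat.choose_eq_zero_of_lt (by omega : j + 1 < i + 1),
      Nat.choose_eq_zero_of_lt (by omega : j < i + 1), Nat.choose_eq_zero_of_lt h]
    simp

lemma bubbleCoeff_of_lt {k j i : ℕ} (h : j < i) : bubbleCoeff k j i = 0 := by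
  simp [bubbleCoeff, Nat.choose_eq_zero_of_lt h]

/-- The product contains the factor `l = k`. After exactly `k` Laplacians all terms but the top one
therefore cancel, which leaves a single positive power. -/
lemma bubbleCoeff_self_of_lt {k i : ℕ} (h : i < k) : bubbleCoeff k k i = 0 := by
  have : ∏ l ∈ Finset.Ico (i + 1) (k + 1), ((k : ℝ) - l) = 0 :=
    Finset.prod_eq_zero (i := k) (by simp; omega) (sub_self _)
  simp [bubbleCoeff, this]

lemma bubbleCoeff_self (k : ℕ) : bubbleCoeff k k k = 1 := by simp [bubbleCoeff]

lemma bubbleCoeff_zero_zero (k : ℕ) : bubbleCoeff k 0 0 = 1 := by simp [bubbleCoeff]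

/-- Each application sends `t^(-b)` to a combination of `t^(-(b+1))` and `e t^(-(b+2))`, so after
`j` steps the exponents run from `a + j` to `a + 2j`, with `a = (n-2k)/2`. The rising product of the
`a + l` factors out of every coefficient and `bubbleCoeff` is what remains. -/
lemma iterate_negRadialLaplacian_rpow_neg {n k : ℕ} {e : ℝ} (j : ℕ) :
    Set.EqOn ((negRadialLaplacian n e)^[j] (fun t => t ^ (-(((n : ℝ) - 2 * k) / 2))))
      (fun t => ∑ i ∈ Finset.range (j + 1), (4 ^ j *
        (∏ l ∈ Finset.range (j + i), (((n : ℝ) - 2 * k) / 2 + l)) * bubbleCoeff k j i * e ^ i) *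
          t ^ (-(((n : ℝ) - 2 * k) / 2 + j + i))) (Set.Ioi 0) := by
  induction j with
  | zero => intro t ht; simp [bubbleCoeff_zero_zero]
  | succ j ih =>
    set a := ((n : ℝ) - 2 * k) / 2 with ha
    rw [Function.iterate_succ_apply']
    intro t ht
    rw [eqOn_negRadialLaplacian isOpen_Ioi ih ht,
      negRadialLaplacian_sum isOpen_Ioi _ _ _ (fun i => contDiffOn_rpow_neg _ _) ht]
    have hn : (n : ℝ) = 2 * a + 2 * k := by rw [ha]; ring
    let X : ℕ → ℝ := fun i => e ^ i * t ^ (-(a + (j + 1) + i))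
    let p : ℕ → ℝ := fun m => ∏ l ∈ Finset.range m, (a + l)
    have hp : ∀ m, p (m + 1) = p m * (a + m) := fun m => Finset.prod_range_succ _ _
    -- Substituting `n = 2a + 2k`, the coefficient `2b(n - 2b - 2)` at `b = a + j + i` becomes
    -- `4(a+j+i)(k-1-j-i)`, the factor of the recursion.
    have hL : ∀ i, (4 ^ j * p (j + i) * bubbleCoeff k j i * e ^ i) *
        negRadialLaplacian n e (fun t => t ^ (-(a + j + i))) t =
        4 ^ (j + 1) * p (j + 1 + i) * ((k - 1 - j - i) * bubbleCoeff k j i) * X i +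
        4 ^ (j + 1) * p (j + 1 + (i + 1)) * bubbleCoeff k j i * X (i + 1) := by
      intro i
      rw [negRadialLaplacian_rpow_neg _ ht, hn]
      have e1 : p (j + 1 + i) = p (j + i) * (a + j + i) := by
        rw [show j + 1 + i = (j + i) + 1 by ring, hp]; push_cast; ring
      have e2 : p (j + 1 + (i + 1)) = p (j + i) * (a + j + i) * (a + j + i + 1) := by
        rw [show j + 1 + (i + 1) = (j + i + 1) + 1 by ring, hp, hp]; push_cast; ring
      have e3 : t ^ (-(a + j + i + 1)) = t ^ (-(a + (j + 1) + i)) := by congr 1; ring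
      have e4 : t ^ (-(a + j + i + 2)) = t ^ (-(a + (j + 1) + ((i + 1 : ℕ) : ℝ))) := by
        congr 1; push_cast; ring
      simp only [X]
      rw [e1, e2, e3, e4]
      ring
    have hR : ∀ i, (4 ^ (j + 1) * p (j + 1 + i) * bubbleCoeff k (j + 1) i * e ^ i) *
        t ^ (-(a + ((j + 1 : ℕ) : ℝ) + i)) =
        4 ^ (j + 1) * p (j + 1 + i) * bubbleCoeff k (j + 1) i * X i := by
      intro i
      simp only [X]; push_cast; ring
    simp only
    rw [Finset.sum_congr rfl fun i _ => hL i, Finset.sum_congr rfl fun i _ => hR i,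
      Finset.sum_range_succ' (n := j + 1), bubbleCoeff_succ_zero]
    simp only [bubbleCoeff_succ_succ]
    -- An index shift; the sum may be extended by the term `i = j + 1` because its coefficient is
    -- zero.
    have h0 : ∑ i ∈ Finset.range (j + 1),
        4 ^ (j + 1) * p (j + 1 + i) * ((k - 1 - j - i) * bubbleCoeff k j i) * X i =
        ∑ i ∈ Finset.range (j + 1), 4 ^ (j + 1) * p (j + 1 + (i + 1)) *
          ((k - 1 - j - ((i : ℝ) + 1)) * bubbleCoeff k j (i + 1)) * X (i + 1) +
        4 ^ (j + 1) * p (j + 1) * ((k - 1 - j) * bubbleCoeff k j 0) * X 0 := by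
      have h1 := Finset.sum_range_succ' (fun i : ℕ =>
        4 ^ (j + 1) * p (j + 1 + i) * ((k - 1 - j - i) * bubbleCoeff k j i) * X i) (j + 1)
      rw [Finset.sum_range_succ, bubbleCoeff_of_lt (Nat.lt_succ_self j)] at h1
      simpa using h1
    rw [Finset.sum_add_distrib, h0, add_right_comm, ← Finset.sum_add_distrib, add_zero]
    congr 1
    exact Finset.sum_congr rfl fun i _ => by ring

/-- The constant in `(-Δ)^k (|x|² + e)^(-(n-2k)/2) = K e^k (|x|² + e)^(-(n+2k)/2)`. -/
def bubbleConst (n k : ℕ) : ℝ :=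
  4 ^ k * ∏ l ∈ Finset.range (2 * k), (((n : ℝ) - 2 * k) / 2 + l)

lemma bubbleConst_pos {n k : ℕ} (hkn : 2 * k < n) : 0 < bubbleConst n k := by
  have h : (0 : ℝ) < (n : ℝ) - 2 * k := by
    have : ((2 * k : ℕ) : ℝ) < n := by exact_mod_cast hkn
    push_cast at this; linarith
  exact mul_pos (by positivity) (Finset.prod_pos fun l _ => by positivity)

lemma iterate_negRadialLaplacian_bubble {n k : ℕ} {e t : ℝ} (ht : 0 < t) :
    (negRadialLaplacian n e)^[k] (fun t => t ^ (-(((n : ℝ) - 2 * k) / 2))) t =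
      bubbleConst n k * e ^ k * t ^ (-(((n : ℝ) + 2 * k) / 2)) := by
  rw [iterate_negRadialLaplacian_rpow_neg k ht]
  simp only
  rw [Finset.sum_range_succ, Finset.sum_eq_zero, bubbleCoeff_self]
  · rw [bubbleConst, two_mul k]
    rw [show -(((n : ℝ) - 2 * k) / 2 + k + k) = -(((n : ℝ) + 2 * k) / 2) by ring]
    ring
  · intro i hi
    rw [bubbleCoeff_self_of_lt (Finset.mem_range.mp hi)]
    ring

/-- The iterate is a polynomial in `e` whose coefficients are smooth functions of `t` not depending
on `e`, so compactness of `[1, 4]` suffices. Uniformity in `e` is needed because `e` will be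
`ε²/R²`. -/
lemma exists_bound_iterate_negRadialLaplacian {n : ℕ} (k : ℕ) {F : ℝ → ℝ}
    (hF : ContDiffOn ℝ ∞ F (Set.Ioi 0)) : ∃ C : ℝ, 0 ≤ C ∧ ∀ e ∈ Set.Icc (0 : ℝ) 1,
      ∀ t ∈ Set.Icc (1 : ℝ) 4, |(negRadialLaplacian n e)^[k] F t| ≤ C := by
  have hfam : ∃ (M : ℕ) (G : ℕ → ℝ → ℝ), (∀ j, ContDiffOn ℝ ∞ (G j) (Set.Ioi 0)) ∧
      ∀ e, Set.EqOn ((negRadialLaplacian n e)^[k] F)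
        (fun t => ∑ j ∈ Finset.range M, e ^ j * G j t) (Set.Ioi 0) := by
    induction k with
    | zero => exact ⟨1, fun _ => F, fun _ => hF, fun e t _ => by simp⟩
    | succ k ih =>
      obtain ⟨M, G, hG, h⟩ := ih
      have hG1 : ∀ j, ContDiffOn ℝ ∞ (deriv (G j)) (Set.Ioi 0) := fun j =>
        (hG j).deriv_of_isOpen isOpen_Ioi (by simp)
      have hG2 : ∀ j, ContDiffOn ℝ ∞ (deriv (deriv (G j))) (Set.Ioi 0) := fun j =>
        (hG1 j).deriv_of_isOpen isOpen_Ioi (by simp)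
      -- Sort by powers of `e`: `-(4tG'' + 2nG')` keeps the power, and `4eG''` raises it by one.
      refine ⟨M + 1, fun j t =>
        (if j < M then -(4 * t * deriv (deriv (G j)) t + 2 * n * deriv (G j) t)
          else 0) + (if 0 < j then 4 * deriv (deriv (G (j - 1))) t else 0),
        fun j => ?_, fun e t ht => ?_⟩
      · have := hG1 j
        have := hG2 j
        have := hG2 (j - 1)
        beta_reduce
        split_ifs <;> fun_prop
      · rw [Function.iterate_succ_apply', eqOn_negRadialLaplacian isOpen_Ioi (h e) ht,
          negRadialLaplacian_sum isOpen_Ioi _ _ _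
            (fun i => by simpa using contDiffOn_infty.1 (hG i) 2) ht]
        simp only [mul_add, Finset.sum_add_distrib]
        rw [Finset.sum_range_succ, Finset.sum_range_succ' (n := M)]
        simp only [lt_irrefl, if_false, mul_zero, add_zero, Nat.succ_pos, if_true,
          Nat.add_sub_cancel]
        rw [← Finset.sum_add_distrib]
        refine Finset.sum_congr rfl fun i hi => ?_
        rw [if_pos (Finset.mem_range.mp hi)]
        simp only [negRadialLaplacian]
        ring
  obtain ⟨M, G, hG, h⟩ := hfam
  have hb : ∀ j, ∃ C, ∀ t ∈ Set.Icc (1 : ℝ) 4, ‖G j t‖ ≤ C := fun j =>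
    isCompact_Icc.exists_bound_of_continuousOn
      ((hG j).continuousOn.mono fun t ht => lt_of_lt_of_le one_pos ht.1)
  choose C hC using hb
  refine ⟨∑ j ∈ Finset.range M, |C j|, by positivity, fun e he t ht => ?_⟩
  rw [h e (lt_of_lt_of_le one_pos ht.1)]
  refine (Finset.abs_sum_le_sum_abs _ _).trans (Finset.sum_le_sum fun j _ => ?_)
  rw [abs_mul, abs_pow, abs_of_nonneg he.1]
  calc e ^ j * |G j t| ≤ 1 * |C j| :=
        mul_le_mul (pow_le_one₀ he.1 he.2) ((hC j t ht).trans (le_abs_self _)) (abs_nonneg _)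
          zero_le_one
    _ = _ := one_mul _

/-! ### Truncated powers as test functions. -/

/-- The truncated power `(1 - t)₊ ^ m`. -/
def truncPow (m : ℕ) (t : ℝ) : ℝ := max (1 - t) 0 ^ m

lemma truncPow_succ {m : ℕ} (hm : 1 ≤ m) (t : ℝ) : truncPow (m + 1) t = truncPow m t * (1 - t) := by
  unfold truncPow
  rcases le_total t 1 with h | h
  · rw [max_eq_left (by linarith), pow_succ]
  · rw [max_eq_right (by linarith), zero_pow (by omega), zero_pow (by omega), zero_mul]

lemma hasDerivAt_truncPow {m : ℕ} (hm : 1 ≤ m) (t : ℝ) :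
    HasDerivAt (truncPow (m + 1)) (-(m + 1) * truncPow m t) t := by
  rcases lt_trichotomy t 1 with h | h | h
  · have h1 : truncPow (m + 1) =ᶠ[𝓝 t] fun t => (1 - t) ^ (m + 1) := by
      filter_upwards [gt_mem_nhds h] with y hy
      rw [truncPow, max_eq_left (by linarith)]
    have h2 := ((hasDerivAt_id t).const_sub 1).pow (m + 1)
    refine (h2.congr_of_eventuallyEq h1).congr_deriv ?_
    rw [truncPow, max_eq_left (by linarith)]
    simp
    ring
  · subst h
    -- At the corner the function is `O(|x - 1|^(m+1))` with `m + 1 ≥ 2`, so its derivative there is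
    -- zero.
    have h1 : (truncPow (m + 1)) =O[𝓝 1] fun x : ℝ => ‖x - 1‖ ^ (m + 1) := by
      refine Asymptotics.IsBigO.of_bound 1 (Eventually.of_forall fun x => ?_)
      rw [one_mul, norm_pow, norm_norm, truncPow, norm_pow,
        Real.norm_of_nonneg (le_max_right _ _)]
      gcongr
      rw [Real.norm_eq_abs, abs_sub_comm]
      exact max_le (le_abs_self _) (abs_nonneg _)
    have h2 := (h1.hasFDerivAt (𝕜 := ℝ) (by omega)).hasDerivAt
    refine h2.congr_deriv ?_
    rw [truncPow]
    simp
    right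
    omega
  · have h1 : truncPow (m + 1) =ᶠ[𝓝 t] fun t => 0 := by
      filter_upwards [lt_mem_nhds h] with y hy
      rw [truncPow, max_eq_right (by linarith), zero_pow (by omega)]
    refine ((hasDerivAt_const t (0 : ℝ)).congr_of_eventuallyEq h1).congr_deriv ?_
    rw [truncPow, max_eq_right (by linarith), zero_pow (by omega), mul_zero]

lemma continuous_truncPow (m : ℕ) : Continuous (truncPow m) := by
  unfold truncPow; fun_prop

lemma contDiff_truncPow (m : ℕ) : ContDiff ℝ m (truncPow (m + 1)) := by
  induction m with
  | zero => simpa using continuous_truncPow 1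
  | succ m ih =>
    have h : deriv (truncPow (m + 1 + 1)) = fun t => -((m + 1 : ℕ) + 1) * truncPow (m + 1) t :=
      funext fun t => (hasDerivAt_truncPow (by omega) t).deriv
    push_cast
    refine contDiff_succ_iff_deriv.mpr
      ⟨fun t => (hasDerivAt_truncPow (by omega) t).differentiableAt, by simp, ?_⟩
    rw [h]
    exact contDiff_const.mul ih

lemma deriv_truncPow_mul_polynomial {m : ℕ} (hm : 1 ≤ m) (r : Polynomial ℝ) :
    deriv (fun t => truncPow (m + 1) t * r.eval t) = fun t => truncPow m t *
      (-(m + 1 : Polynomial ℝ) * r + (1 - Polynomial.X) * Polynomial.derivative r).eval t := by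
  ext t
  have h := ((hasDerivAt_truncPow hm t).mul (r.hasDerivAt t)).deriv
  rw [truncPow_succ hm] at h
  refine h.trans ?_
  simp
  ring

/-- Each derivative lowers the truncated power by one and leaves a polynomial factor, so `k`
Laplacians use up `2k` powers. Retaining the factor `(1 - t)₊^m` is what later lets the equation
absorb the error. -/
lemma iterate_negRadialLaplacian_truncPow {n : ℕ} (k : ℕ) {m : ℕ} (hm : 1 ≤ m) :
    ∃ r : Polynomial ℝ, (negRadialLaplacian n 0)^[k] (truncPow (m + 2 * k)) =
      fun t => truncPow m t * r.eval t := by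
  induction k generalizing m with
  | zero => exact ⟨1, by simp⟩
  | succ k ih =>
    obtain ⟨r, hr⟩ := ih (m := m + 2) (by omega)
    rw [Function.iterate_succ_apply', show m + 2 * (k + 1) = m + 2 + 2 * k by ring, hr]
    have h1 := deriv_truncPow_mul_polynomial (m := m + 1) (by omega) r
    set r1 := (-((m + 1 : ℕ) + 1 : Polynomial ℝ) * r + (1 - Polynomial.X) * Polynomial.derivative r)
    have h2 := deriv_truncPow_mul_polynomial hm r1
    set r2 := (-(m + 1 : Polynomial ℝ) * r1 + (1 - Polynomial.X) * Polynomial.derivative r1)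
    refine ⟨-(4 * (Polynomial.X : Polynomial ℝ) * r2 + 2 * (n : Polynomial ℝ) *
      (1 - (Polynomial.X : Polynomial ℝ)) * r1), ?_⟩
    ext t
    unfold negRadialLaplacian
    rw [h1, h2]
    simp only
    rw [truncPow_succ hm]
    simp
    ring

lemma abs_iterate_negRadialLaplacian_truncPow_le {n : ℕ} (k : ℕ) {m : ℕ} (hm : 1 ≤ m) :
    ∃ C : ℝ, 0 ≤ C ∧ ∀ t, 0 ≤ t →
      |(negRadialLaplacian n 0)^[k] (truncPow (m + 2 * k)) t| ≤ C * truncPow m t := by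
  obtain ⟨r, hr⟩ := iterate_negRadialLaplacian_truncPow (n := n) k hm
  obtain ⟨C, hC⟩ := (isCompact_Icc (a := (0 : ℝ)) (b := 1)).exists_bound_of_continuousOn
    r.continuous.continuousOn
  have hC0 : 0 ≤ C := (norm_nonneg _).trans (hC 0 (by simp))
  refine ⟨C, hC0, fun t ht => ?_⟩
  rw [hr]
  simp only
  have h0 : 0 ≤ truncPow m t := pow_nonneg (le_max_right _ _) _
  rw [abs_mul, abs_of_nonneg h0, mul_comm]
  rcases le_total t 1 with h | h
  · gcongr
    exact hC t ⟨ht, h⟩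
  · have : truncPow m t = 0 := by
      rw [truncPow, max_eq_right (by linarith), zero_pow (by omega)]
    simp [this]

/-! ### The a priori estimate and decay of averages. -/

/-- `u` is continuous, nonnegative, `C^{2k}` off the origin, where `(-Δ)^k u = h ≥ 0`. -/
structure PolyharmonicAwayFromZero (n k : ℕ) (u h : Rn n → ℝ) : Prop where
  cont : Continuous u
  nonneg : ∀ x, 0 ≤ u x
  smooth : ContDiffOn ℝ ((2 * k : ℕ) : ℕ∞ω) u {x | x ≠ 0}
  eq : ∀ x, x ≠ 0 → negLaplacianPow n k u x = h x
  rhs_nonneg : ∀ x, x ≠ 0 → 0 ≤ h x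

/-- The test function `(1 - |y|² / R²)₊ ^ m`. -/
def truncTest (n m : ℕ) (R : ℝ) (y : Rn n) : ℝ := truncPow m (radialQuad ((R⁻¹) ^ 2) 0 0 y)

lemma truncPow_nonneg (m : ℕ) (t : ℝ) : 0 ≤ truncPow m t := pow_nonneg (le_max_right _ _) _

lemma truncTest_nonneg {n m : ℕ} {R : ℝ} (y : Rn n) : 0 ≤ truncTest n m R y := truncPow_nonneg _ _

lemma truncTest_eq_zero {n m : ℕ} (hm : m ≠ 0) {R : ℝ} (hR : 0 < R) {y : Rn n} (hy : R ≤ ‖y‖) :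
    truncTest n m R y = 0 := by
  unfold truncTest truncPow radialQuad
  have : 1 ≤ R⁻¹ * ‖y‖ := by
    rw [inv_mul_eq_div, one_le_div hR]; exact hy
  rw [max_eq_right, zero_pow hm]
  rw [sub_zero, add_zero, ← mul_pow]
  have := one_le_pow₀ (n := 2) this
  linarith

lemma hasCompactSupport_truncTest {n m : ℕ} (hm : m ≠ 0) {R : ℝ} (hR : 0 < R) :
    HasCompactSupport (truncTest n m R) :=
  HasCompactSupport.intro (isCompact_closedBall (0 : Rn n) R) fun y hy =>
    truncTest_eq_zero hm hR (by simpa using (not_le.mp (fun h => hy (by simpa using h))).le)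

lemma contDiff_truncTest {n m N : ℕ} (h : N + 1 ≤ m) (R : ℝ) :
    ContDiff ℝ (N : ℕ∞ω) (truncTest n m R) := by
  obtain ⟨j, rfl⟩ : ∃ j, m = j + 1 := ⟨m - 1, by omega⟩
  have h1 : ContDiff ℝ (N : ℕ∞ω) (truncPow (j + 1)) :=
    (contDiff_truncPow j).of_le (by norm_cast; omega)
  exact h1.comp (contDiff_radialQuad _ _ _)

lemma abs_negLaplacianPow_truncTest_le {n : ℕ} (k : ℕ) {m : ℕ} (hm : 1 ≤ m) :
    ∃ C : ℝ, 0 ≤ C ∧ ∀ R y, |negLaplacianPow n k (truncTest n (m + 2 * k) R) y| ≤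
      C * (R⁻¹) ^ (2 * k) * truncTest n m R y := by
  obtain ⟨C, hC, h⟩ := abs_iterate_negRadialLaplacian_truncPow_le (n := n) k hm
  refine ⟨C, hC, fun R y => ?_⟩
  have hs : ContDiff ℝ ((2 * k : ℕ) : ℕ∞ω) (truncPow (m + 2 * k)) := by
    obtain ⟨j, rfl⟩ : ∃ j, m = j + 1 := ⟨m - 1, by omega⟩
    rw [show j + 1 + 2 * k = (j + 2 * k) + 1 by ring]
    exact (contDiff_truncPow (j + 2 * k)).of_le (by norm_cast; omega)
  have e := negLaplacianPow_comp_radialQuad (n := n) k (s := (R⁻¹) ^ 2) (e := 0) (x₀ := 0)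
    isOpen_univ (fun _ => Set.mem_univ _) hs.contDiffOn
  have e2 : truncTest n (m + 2 * k) R =
    fun y => truncPow (m + 2 * k) (radialQuad ((R⁻¹) ^ 2) 0 0 y) := rfl
  rw [e2, e]
  simp only
  rw [abs_mul, abs_of_nonneg (by positivity), ← pow_mul]
  calc _ ≤ (R⁻¹) ^ (2 * k) * (C * truncPow m (radialQuad ((R⁻¹) ^ 2) 0 0 y)) := by
        gcongr
        · rw [pow_mul]; positivity
        · exact h _ (by unfold radialQuad; positivity)
    _ = _ := by unfold truncTest; ring

/-- A pointwise Young inequality, with the power of the test function absorbed. -/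
lemma mul_pow_le_add_of_absorbing {A B u η p w : ℝ} {m j : ℕ} (hA : 0 ≤ A) (hB : 0 < B)
    (hu : 0 ≤ u) (hη : 0 ≤ η) (hη1 : η ≤ 1) (hp : 1 < p) (hm : (j : ℝ) ≤ m * (p - 1))
    (hw : 0 < w) (hw1 : A ≤ B * w) :
    A * (u * η ^ m) ≤ w * (u ^ p * η ^ (m + j)) + A * B ^ (1 / (p - 1)) := by
  have hp1 : 0 < p - 1 := by linarith
  -- If `A ≤ w u^(p-1) η^j`, the left side is already at most the first term. Otherwise `w u^(p-1)
  -- η^j ≤ A ≤ B w` gives `u^(p-1) η^j ≤ B`, and since `η ≤ 1` and `j ≤ m(p-1)` this bounds `(u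
  -- η^m)^(p-1)` by `B`.
  rcases le_total A (w * (u ^ (p - 1) * η ^ j)) with h | h
  · have : u ^ p = u * u ^ (p - 1) := by
      rw [← Real.rpow_one_add' hu (by linarith)]; congr 1; ring
    rw [this, pow_add]
    have h1 : A * (u * η ^ m) ≤ w * (u ^ (p - 1) * η ^ j) * (u * η ^ m) := by gcongr
    have h2 : 0 ≤ A * B ^ (1 / (p - 1)) := by positivity
    linarith
  · have h1 : u ^ (p - 1) * η ^ j ≤ B := by
      have : w * (u ^ (p - 1) * η ^ j) ≤ w * B := by linarith
      exact le_of_mul_le_mul_left this hw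
    have h2 : (u * η ^ m) ^ (p - 1) ≤ B := by
      refine le_trans ?_ h1
      rw [Real.mul_rpow hu (by positivity), ← Real.rpow_natCast, ← Real.rpow_natCast,
        ← Real.rpow_mul hη]
      gcongr 1
      rcases hη.eq_or_lt with h0 | h0
      · subst h0
        rcases Nat.eq_zero_or_pos j with hj | hj
        · subst hj
          simp only [Nat.cast_zero, Real.rpow_zero]
          exact Real.rpow_le_one le_rfl zero_le_one (by positivity)
        · have hj' : (0 : ℝ) < j := by exact_mod_cast hj
          rw [Real.zero_rpow (by linarith), Real.zero_rpow (by linarith)]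
      · exact Real.rpow_le_rpow_of_exponent_ge h0 hη1 hm
    have h3 : u * η ^ m ≤ B ^ (1 / (p - 1)) := by
      have := Real.rpow_le_rpow (by positivity) h2 (by positivity : 0 ≤ 1 / (p - 1))
      rwa [← Real.rpow_mul (by positivity), mul_one_div_cancel hp1.ne', Real.rpow_one] at this
    have h4 : 0 ≤ w * (u ^ p * η ^ (m + j)) := by positivity
    have h5 : A * (u * η ^ m) ≤ A * B ^ (1 / (p - 1)) := by gcongr
    linarith

lemma exists_nat_le_mul_sub_one {L : ℕ} (p : Fin L → ℝ) (hp : ∀ i, 1 < p i) (j : ℕ) :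
    ∃ m : ℕ, 1 ≤ m ∧ ∀ i, (j : ℝ) ≤ m * (p i - 1) := by
  have h : ∀ i, ∃ m : ℕ, (j : ℝ) ≤ m * (p i - 1) := fun i => by
    obtain ⟨m, hm⟩ := exists_nat_ge ((j : ℝ) / (p i - 1))
    exact ⟨m, (div_le_iff₀ (by linarith [hp i])).mp hm⟩
  choose m hm using h
  refine ⟨1 + ∑ i, m i, by omega, fun i => (hm i).trans ?_⟩
  have h1 : m i ≤ 1 + ∑ i, m i :=
    (Finset.single_le_sum (f := m) (fun _ _ => Nat.zero_le _) (Finset.mem_univ i)).trans (by omega)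
  have h2 : (m i : ℝ) ≤ ((1 + ∑ i, m i : ℕ) : ℝ) := by exact_mod_cast h1
  have := hp i
  gcongr

/-- A priori estimate of the right-hand sides, by the rescaled test functions. -/
lemma exists_sum_integral_mul_truncTest_le {n k L : ℕ} (hkn : 2 * k < n) {u h : Fin L → Rn n → ℝ}
    (hu : ∀ i, PolyharmonicAwayFromZero n k (u i) (h i)) {p : Fin L → ℝ} {s C : ℝ}
    (hp : ∀ i, 1 < p i) (hs0 : 0 ≤ s) (hs : s < 2 * (k : ℝ)) (hC : 0 < C)
    (hgrow : ∀ x : Rn n, x ≠ 0 → C * ‖x‖ ^ (-s) * ∑ i, (u i x) ^ (p i) ≤ ∑ i, h i x) :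
    ∃ (m : ℕ) (D : ℝ), 1 ≤ m ∧ 0 ≤ D ∧ ∀ R : ℝ, 1 ≤ R →
      (∀ i, Integrable (fun y => h i y * truncTest n (m + 2 * k) R y)) ∧
      ∑ i, ∫ y, h i y * truncTest n (m + 2 * k) R y ≤ D * (R⁻¹) ^ (2 * k) * R ^ n := by
  have : Nontrivial (Rn n) := by
    have : Nonempty (Fin n) := ⟨⟨0, by omega⟩⟩
    infer_instance
  have haeh : ∀ᵐ x : Rn n, x ≠ 0 := by simp [ae_iff, measure_singleton]
  obtain ⟨m, hm, hmp⟩ := exists_nat_le_mul_sub_one p hp (2 * k)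
  obtain ⟨A, hA, hAb⟩ := abs_negLaplacianPow_truncTest_le (n := n) k hm
  set V := (volume : Measure (Rn n)).real (ball 0 1)
  -- Chosen so that `B · (C/2) = A + 1`: the weight `C/2`, half the growth constant, lets half of
  -- the right-hand side be absorbed, and the `+ 1` keeps `B` positive even if `A = 0`.
  set B := 2 * (A + 1) / C with hB
  have hB0 : 0 < B := by positivity
  refine ⟨m, 2 * (∑ i, A * B ^ (1 / (p i - 1))) * V, hm, ?_, fun R hR => ?_⟩
  · have : 0 ≤ ∑ i, A * B ^ (1 / (p i - 1)) := Finset.sum_nonneg fun i _ => by positivity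
    positivity
  have hR0 : 0 < R := by linarith
  set φ := truncTest n (m + 2 * k) R with hφ
  have hφs : ContDiff ℝ ((2 * k : ℕ) : ℕ∞ω) φ := contDiff_truncTest (by omega) R
  have hφc : HasCompactSupport φ := hasCompactSupport_truncTest (by omega) hR0
  have hφ0 : ∀ y, 0 ≤ φ y := truncTest_nonneg
  have hweak := fun i => integral_mul_negLaplacianPow_of_nonneg hkn (hu i).cont (hu i).smooth
    (hu i).eq (hu i).rhs_nonneg hφs hφc hφ0
  refine ⟨fun i => (hweak i).1, ?_⟩
  set S := ∑ i, ∫ y, h i y * φ y with hS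
  set E := ∑ i, A * B ^ (1 / (p i - 1)) with hE
  have hEn : 0 ≤ E := Finset.sum_nonneg fun i _ => by positivity
  have hpt : ∀ y ∈ closedBall (0 : Rn n) R, y ≠ 0 →
      ∑ i, u i y * negLaplacianPow n k φ y ≤ (1 / 2) * (∑ i, h i y * φ y) +
        E * (R⁻¹) ^ (2 * k) := by
    intro y hy hy0
    have hyR : ‖y‖ ≤ R := by simpa using hy
    have hyp : 0 < ‖y‖ := norm_pos_iff.mpr hy0
    set η := max (1 - radialQuad ((R⁻¹) ^ 2) 0 0 y) 0
    have hη0 : 0 ≤ η := le_max_right _ _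
    have hη1 : η ≤ 1 := max_le (by
      have : 0 ≤ radialQuad ((R⁻¹) ^ 2) 0 0 y := by unfold radialQuad; positivity
      linarith) zero_le_one
    have hφy : φ y = η ^ (m + 2 * k) := rfl
    have hRk : (0 : ℝ) < R⁻¹ ^ (2 * k) := by positivity
    have hterm : ∀ i, u i y * negLaplacianPow n k φ y ≤
        (C / 2 * ‖y‖ ^ (-s)) * (u i y ^ p i * η ^ (m + 2 * k)) +
        A * B ^ (1 / (p i - 1)) * (R⁻¹) ^ (2 * k) := by
      intro i
      have hw : A ≤ B * (C / 2 * ‖y‖ ^ (-s) * R ^ (2 * k)) := by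
        -- On `B_R` with `R ≥ 1` the weight is at least `R^(2k-s) ≥ 1`, because `0 ≤ s < 2k`.
        have h1 : 1 ≤ ‖y‖ ^ (-s) * R ^ (2 * k) := by
          have h2 : R ^ (-s) ≤ ‖y‖ ^ (-s) := Real.rpow_le_rpow_of_nonpos hyp hyR (by linarith)
          have h3 : 1 ≤ R ^ (-s) * R ^ (2 * k) := by
            rw [← Real.rpow_natCast, ← Real.rpow_add hR0]
            exact Real.one_le_rpow hR (by push_cast; linarith)
          refine h3.trans ?_
          gcongr
        have h4 : B * (C / 2) = A + 1 := by rw [hB]; field_simp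
        calc A ≤ (A + 1) * 1 := by linarith
          _ ≤ (A + 1) * (‖y‖ ^ (-s) * R ^ (2 * k)) := by gcongr
          _ = _ := by rw [← h4]; ring
      have key := mul_pow_le_add_of_absorbing (j := 2 * k) (m := m) hA hB0 ((hu i).nonneg y) hη0 hη1
        (hp i) (by exact_mod_cast hmp i) (by positivity) hw
      have h6 : u i y * negLaplacianPow n k φ y ≤ (R⁻¹) ^ (2 * k) * (A * (u i y * η ^ m)) := by
        have h7 := (le_abs_self _).trans (hAb R y)
        calc _ ≤ u i y * (A * (R⁻¹) ^ (2 * k) * truncTest n m R y) :=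
              mul_le_mul_of_nonneg_left h7 ((hu i).nonneg y)
          _ = _ := by
            have : truncTest n m R y = η ^ m := rfl
            rw [this]; ring
      refine h6.trans ((mul_le_mul_of_nonneg_left key hRk.le).trans (le_of_eq ?_))
      rw [inv_pow]
      field_simp
    refine (Finset.sum_le_sum fun i _ => hterm i).trans ?_
    rw [Finset.sum_add_distrib, ← Finset.mul_sum, ← Finset.sum_mul, ← Finset.sum_mul,
      ← Finset.sum_mul]
    have h8 := hgrow y hy0
    have h9 : 0 ≤ φ y := hφ0 y
    have h10 := mul_le_mul_of_nonneg_right h8 h9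
    rw [hφy] at h10 ⊢
    nlinarith [h10]
  have hint1 : ∀ i, Integrable (fun y => u i y * negLaplacianPow n k φ y) := fun i =>
    ((hu i).cont.mul (continuous_negLaplacianPow hφs)).integrable_of_hasCompactSupport
      (hφc.negLaplacianPow k).mul_left
  have hzero : ∀ y ∉ closedBall (0 : Rn n) R, φ y = 0 ∧ negLaplacianPow n k φ y = 0 := by
    intro y hy
    have hy' : R < ‖y‖ := by simpa using hy
    refine ⟨truncTest_eq_zero (by omega) hR0 hy'.le, ?_⟩
    have hev : φ =ᶠ[𝓝 y] fun _ => 0 := by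
      filter_upwards [continuous_norm.continuousAt.eventually (lt_mem_nhds hy')] with z hz
      exact truncTest_eq_zero (by omega) hR0 hz.le
    rw [(negLaplacianPow_congr k hev).eq_of_nhds, negLaplacianPow_fun_zero]
  -- `S` is a finite number, as the removability step gave integrability; half of it can be moved to
  -- the left.
  have hSle : S ≤ (1 / 2) * S + E * (R⁻¹) ^ (2 * k) * (V * R ^ n) := by
    have e1 : S = ∫ y in closedBall (0 : Rn n) R, ∑ i, u i y * negLaplacianPow n k φ y := by
      rw [setIntegral_eq_integral_of_forall_compl_eq_zero, integral_finsetSum _ fun i _ => hint1 i]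
      · exact Finset.sum_congr rfl fun i _ => (hweak i).2.symm
      · intro y hy
        simp [(hzero y hy).2]
    have e2 : S = ∫ y in closedBall (0 : Rn n) R, ∑ i, h i y * φ y := by
      rw [setIntegral_eq_integral_of_forall_compl_eq_zero,
        integral_finsetSum _ fun i _ => (hweak i).1]
      intro y hy
      simp [(hzero y hy).1]
    have e3 : ∫ y in closedBall (0 : Rn n) R, ((1 / 2) * (∑ i, h i y * φ y) +
        E * (R⁻¹) ^ (2 * k)) = (1 / 2) * S + E * (R⁻¹) ^ (2 * k) * (V * R ^ n) := by
      rw [integral_add, integral_const_mul, ← e2, setIntegral_const,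
        Measure.addHaar_real_closedBall,
        finrank_euclideanSpace_fin, smul_eq_mul]
      · ring
      · exact hR0.le
      · exact ((integrable_finsetSum _ fun i _ => (hweak i).1).const_mul _).integrableOn
      · exact integrableOn_const measure_closedBall_lt_top.ne
    conv_lhs => rw [e1]
    rw [← e3]
    refine setIntegral_mono_on_ae ?_ ?_ measurableSet_closedBall ?_
    · exact (integrable_finsetSum _ fun i _ => hint1 i).integrableOn
    · exact ((integrable_finsetSum _ fun i _ => (hweak i).1).const_mul _).integrableOn.add
        (integrableOn_const measure_closedBall_lt_top.ne)
    · filter_upwards [haeh] with y hy0 hy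
      exact hpt y hy hy0
  linarith

/-- For `u ≥ τ` one has `u^(1-p) ≤ τ^(1-p)`. This replaces Hölder's inequality in passing from
averages of `u^p` to averages of `u`. -/
lemma le_add_rpow_mul_rpow {u τ p : ℝ} (hu : 0 ≤ u) (hτ : 0 < τ) (hp : 1 < p) :
    u ≤ τ + τ ^ (1 - p) * u ^ p := by
  rcases le_total u τ with h | h
  · have : 0 ≤ τ ^ (1 - p) * u ^ p := by positivity
    linarith
  · have hu0 : 0 < u := by linarith
    have h1 : u = u ^ (1 - p) * u ^ p := by
      rw [← Real.rpow_add hu0, sub_add_cancel, Real.rpow_one]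
    have h2 : u ^ (1 - p) ≤ τ ^ (1 - p) := Real.rpow_le_rpow_of_nonpos hτ h (by linarith)
    have h3 : u ^ (1 - p) * u ^ p ≤ τ ^ (1 - p) * u ^ p := by gcongr
    linarith

lemma three_quarters_pow_le_truncTest {n m : ℕ} {R : ℝ} (hR : 0 < R) {y : Rn n} (hy : ‖y‖ ≤ R) :
    (3 / 4 : ℝ) ^ m ≤ truncTest n m (2 * R) y := by
  unfold truncTest truncPow radialQuad
  have h1 : ((2 * R)⁻¹) ^ 2 * ‖y‖ ^ 2 ≤ 1 / 4 := by
    rw [← mul_pow]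
    have : (2 * R)⁻¹ * ‖y‖ ≤ 1 / 2 := by
      rw [inv_mul_le_iff₀ (by positivity)]; linarith
    have h0 : 0 ≤ (2 * R)⁻¹ * ‖y‖ := by positivity
    nlinarith
  gcongr
  refine le_trans ?_ (le_max_left _ _)
  rw [sub_zero]
  linarith

/-- The averages of the components over large balls tend to zero. -/
lemma eventually_setIntegral_closedBall_le {n k L : ℕ} (hkn : 2 * k < n) {u h : Fin L → Rn n → ℝ}
    (hu : ∀ i, PolyharmonicAwayFromZero n k (u i) (h i)) {p : Fin L → ℝ} {s C : ℝ}
    (hp : ∀ i, 1 < p i) (hs0 : 0 ≤ s) (hs : s < 2 * (k : ℝ)) (hC : 0 < C)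
    (hgrow : ∀ x : Rn n, x ≠ 0 → C * ‖x‖ ^ (-s) * ∑ i, (u i x) ^ (p i) ≤ ∑ i, h i x)
    (i : Fin L) {ε : ℝ} (hε : 0 < ε) :
    ∀ᶠ R : ℝ in atTop, ∫ y in closedBall (0 : Rn n) R, u i y ≤ ε * R ^ n := by
  have : Nontrivial (Rn n) := by
    have : Nonempty (Fin n) := ⟨⟨0, by omega⟩⟩
    infer_instance
  have haeh : ∀ᵐ x : Rn n, x ≠ 0 := by simp [ae_iff, measure_singleton]
  obtain ⟨m, D, hm, hD, hb⟩ := exists_sum_integral_mul_truncTest_le hkn hu hp hs0 hs hC hgrow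
  set V := (volume : Measure (Rn n)).real (ball 0 1)
  have hV : 0 ≤ V := measureReal_nonneg
  -- Small enough that the constant part of the average, `V τ`, is at most `ε/2`.
  set τ := ε / (2 * (V + 1)) with hτ
  have hτ0 : 0 < τ := by positivity
  set K := C⁻¹ * (4 / 3) ^ (m + 2 * k) * (D * 2 ^ n) with hK
  -- On `B_R` the growth condition gives `u_i^(p_i) ≤ C⁻¹ R^s ∑ h_j`. The a priori estimate is used
  -- at radius `2R`, since the test function then stays above a positive constant on `B_R`.
  have hup : ∀ R : ℝ, 1 ≤ R →
      ∫ y in closedBall (0 : Rn n) R, u i y ^ p i ≤ K * R ^ (s - 2 * k) * R ^ n := by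
    intro R hR
    have hR0 : 0 < R := by linarith
    obtain ⟨hint, hsum⟩ := hb (2 * R) (by linarith)
    have hpt : ∀ y ∈ closedBall (0 : Rn n) R, y ≠ 0 → u i y ^ p i ≤
        C⁻¹ * R ^ s * (4 / 3) ^ (m + 2 * k) *
          ∑ j, h j y * truncTest n (m + 2 * k) (2 * R) y := by
      intro y hy hy0
      have hyR : ‖y‖ ≤ R := by simpa using hy
      have hyp : 0 < ‖y‖ := norm_pos_iff.mpr hy0
      have hh : 0 ≤ ∑ j, h j y := Finset.sum_nonneg fun j _ => (hu j).rhs_nonneg y hy0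
      have h1 : u i y ^ p i ≤ ∑ j, u j y ^ p j :=
        Finset.single_le_sum (f := fun j => u j y ^ p j)
          (fun j _ => Real.rpow_nonneg ((hu j).nonneg y) _) (Finset.mem_univ i)
      have h2 := hgrow y hy0
      have h3 : ‖y‖ ^ s ≤ R ^ s := Real.rpow_le_rpow hyp.le hyR hs0
      have h4 : ∑ j, u j y ^ p j ≤ C⁻¹ * ‖y‖ ^ s * ∑ j, h j y := by
        have h5 : ‖y‖ ^ s * ‖y‖ ^ (-s) = 1 := by
          rw [← Real.rpow_add hyp, add_neg_cancel, Real.rpow_zero]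
        calc ∑ j, u j y ^ p j
            = C⁻¹ * ‖y‖ ^ s * (C * ‖y‖ ^ (-s) * ∑ j, u j y ^ p j) := by
              field_simp
              linear_combination (-∑ j, u j y ^ p j) * h5
          _ ≤ _ := by gcongr
      have h6 : (1 : ℝ) ≤ (4 / 3) ^ (m + 2 * k) * truncTest n (m + 2 * k) (2 * R) y := by
        have h7 := three_quarters_pow_le_truncTest (n := n) (m := m + 2 * k) hR0 hyR
        calc (1 : ℝ) = (4 / 3) ^ (m + 2 * k) * (3 / 4) ^ (m + 2 * k) := by
              rw [← mul_pow]; norm_num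
          _ ≤ _ := by gcongr
      rw [← Finset.sum_mul]
      calc u i y ^ p i ≤ C⁻¹ * ‖y‖ ^ s * (∑ j, h j y) * 1 := by
            rw [mul_one]; exact h1.trans h4
        _ ≤ C⁻¹ * R ^ s * (∑ j, h j y) *
            ((4 / 3) ^ (m + 2 * k) * truncTest n (m + 2 * k) (2 * R) y) := by gcongr
        _ = _ := by ring
    have hcont : Continuous fun y => u i y ^ p i :=
      (hu i).cont.rpow_const fun y => Or.inr (by linarith [hp i])
    have hIs : Integrable (fun y => C⁻¹ * R ^ s * (4 / 3) ^ (m + 2 * k) *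
          ∑ j, h j y * truncTest n (m + 2 * k) (2 * R) y) :=
      (integrable_finsetSum _ fun j _ => hint j).const_mul _
    calc ∫ y in closedBall (0 : Rn n) R, u i y ^ p i
        ≤ ∫ y in closedBall (0 : Rn n) R, C⁻¹ * R ^ s * (4 / 3) ^ (m + 2 * k) *
          ∑ j, h j y * truncTest n (m + 2 * k) (2 * R) y := by
          refine setIntegral_mono_on_ae
            (hcont.continuousOn.integrableOn_compact (isCompact_closedBall _ _)) hIs.integrableOn
            measurableSet_closedBall ?_
          filter_upwards [haeh] with y hy0 hy
          exact hpt y hy hy0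
      _ ≤ ∫ y, C⁻¹ * R ^ s * (4 / 3) ^ (m + 2 * k) *
          ∑ j, h j y * truncTest n (m + 2 * k) (2 * R) y := by
          refine setIntegral_le_integral hIs ?_
          filter_upwards [haeh] with y hy0
          have : 0 ≤ ∑ j, h j y * truncTest n (m + 2 * k) (2 * R) y :=
            Finset.sum_nonneg fun j _ => mul_nonneg ((hu j).rhs_nonneg y hy0) (truncTest_nonneg y)
          simp only [Pi.zero_apply]
          positivity
      _ = C⁻¹ * R ^ s * (4 / 3) ^ (m + 2 * k) *
          ∑ j, ∫ y, h j y * truncTest n (m + 2 * k) (2 * R) y := by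
          rw [integral_const_mul, integral_finsetSum _ fun j _ => hint j]
      _ ≤ C⁻¹ * R ^ s * (4 / 3) ^ (m + 2 * k) *
          (D * ((2 * R)⁻¹) ^ (2 * k) * (2 * R) ^ n) := by gcongr
      _ ≤ C⁻¹ * R ^ s * (4 / 3) ^ (m + 2 * k) *
          (D * (R⁻¹) ^ (2 * k) * (2 * R) ^ n) := by
          gcongr; linarith
      _ = K * R ^ (s - 2 * k) * R ^ n := by
          have : R ^ (s - 2 * (k : ℝ)) = R ^ s * (R⁻¹) ^ (2 * k) := by
            rw [Real.rpow_sub hR0, div_eq_mul_inv, inv_pow, ← Real.rpow_natCast R (2 * k)]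
            push_cast
            rfl
          rw [this, hK, mul_pow]; ring
  have hlim : Tendsto (fun R : ℝ => τ ^ (1 - p i) * (K * R ^ (s - 2 * (k : ℝ)))) atTop (𝓝 0) := by
    have h1 : Tendsto (fun R : ℝ => R ^ (s - 2 * (k : ℝ))) atTop (𝓝 0) := by
      have := tendsto_rpow_neg_atTop (y := 2 * (k : ℝ) - s) (by linarith)
      simpa using this
    simpa using (h1.const_mul K).const_mul (τ ^ (1 - p i))
  filter_upwards [eventually_ge_atTop 1, hlim.eventually (gt_mem_nhds (half_pos hε))] with R hR hRl
  have hR0 : 0 < R := by linarith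
  have hcont : Continuous fun y => u i y ^ p i :=
    (hu i).cont.rpow_const fun y => Or.inr (by linarith [hp i])
  have hcI : IntegrableOn (fun y => τ ^ (1 - p i) * u i y ^ p i) (closedBall (0 : Rn n) R) :=
    ((continuous_const.mul hcont).continuousOn.integrableOn_compact (isCompact_closedBall _ _))
  have hcst : IntegrableOn (fun _ : Rn n => τ) (closedBall (0 : Rn n) R) :=
    integrableOn_const measure_closedBall_lt_top.ne
  calc ∫ y in closedBall (0 : Rn n) R, u i y
      ≤ ∫ y in closedBall (0 : Rn n) R, (τ + τ ^ (1 - p i) * u i y ^ p i) := by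
        refine setIntegral_mono_on ((hu i).cont.continuousOn.integrableOn_compact
          (isCompact_closedBall _ _)) (hcst.add hcI) measurableSet_closedBall fun y _ => ?_
        exact le_add_rpow_mul_rpow ((hu i).nonneg y) hτ0 (hp i)
    _ = V * R ^ n * τ + τ ^ (1 - p i) * ∫ y in closedBall (0 : Rn n) R, u i y ^ p i := by
        rw [integral_add hcst hcI, integral_const_mul, setIntegral_const,
          Measure.addHaar_real_closedBall _ _ hR0.le, finrank_euclideanSpace_fin, smul_eq_mul]
        ring
    _ ≤ V * R ^ n * τ + τ ^ (1 - p i) * (K * R ^ (s - 2 * (k : ℝ)) * R ^ n) := by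
        gcongr
        exact hup R hR
    _ = (V * τ + τ ^ (1 - p i) * (K * R ^ (s - 2 * (k : ℝ)))) * R ^ n := by ring
    _ ≤ ε * R ^ n := by
        gcongr
        have : V * τ ≤ ε / 2 := by
          rw [hτ]
          rw [mul_div_assoc', div_le_div_iff₀ (by positivity) (by positivity)]
          nlinarith
        linarith

/-! ### Bubbles as an approximate identity. -/

/-- The bubble `(-Δ)^k (|y - x₀|² + ε²)^(-(n-2k)/2)`. -/
def bubble (n k : ℕ) (ε : ℝ) (x₀ y : Rn n) : ℝ :=
  bubbleConst n k * (ε ^ 2) ^ k * (radialQuad 1 (ε ^ 2) x₀ y) ^ (-(((n : ℝ) + 2 * k) / 2))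

/-- The total mass of the bubbles; its inverse is the constant in the integral system. -/
def bubbleMass (n k : ℕ) : ℝ := ∫ z : Rn n, bubble n k 1 0 z

lemma continuous_bubble {n k : ℕ} {ε : ℝ} (hε : 0 < ε) (x₀ : Rn n) :
    Continuous (bubble n k ε x₀) := by
  unfold bubble
  refine continuous_const.mul ((continuous_radialQuad _ _ _).rpow_const fun y => Or.inl ?_)
  unfold radialQuad
  positivity

lemma bubble_pos {n k : ℕ} (hkn : 2 * k < n) {ε : ℝ} (hε : 0 < ε) (x₀ y : Rn n) :
    0 < bubble n k ε x₀ y := by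
  have := bubbleConst_pos hkn
  unfold bubble radialQuad
  positivity

lemma integrable_bubble_one {n k : ℕ} (hk : 1 ≤ k) :
    Integrable (fun z : Rn n => bubble n k 1 0 z) := by
  have h1 : (Module.finrank ℝ (Rn n) : ℝ) < (n : ℝ) + 2 * k := by
    rw [finrank_euclideanSpace_fin]
    have : (1 : ℝ) ≤ k := by exact_mod_cast hk
    linarith
  have h := (integrable_rpow_neg_one_add_norm_sq (μ := (volume : Measure (Rn n))) h1).const_mul
    (bubbleConst n k)
  refine h.congr (Eventually.of_forall fun z => ?_)
  simp only [bubble, radialQuad]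
  rw [neg_div, sub_zero, one_mul, one_pow, one_pow, mul_one, add_comm]

lemma bubbleMass_pos {n k : ℕ} (hk : 1 ≤ k) (hkn : 2 * k < n) : 0 < bubbleMass n k := by
  refine (integral_pos_iff_support_of_nonneg (fun z => (bubble_pos hkn one_pos 0 z).le)
    (integrable_bubble_one hk)).mpr ?_
  have : Function.support (fun z : Rn n => bubble n k 1 0 z) = Set.univ :=
    Set.eq_univ_of_forall fun z => (bubble_pos hkn one_pos 0 z).ne'
  rw [this]
  exact Measure.measure_univ_pos.mpr (NeZero.ne _)

lemma bubble_comp_smul {n k : ℕ} {ε : ℝ} (hε : 0 < ε) (x₀ z : Rn n) :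
    ε ^ n * bubble n k ε x₀ (x₀ + ε • z) = bubble n k 1 0 z := by
  unfold bubble radialQuad
  have h1 : (1 : ℝ) * ‖x₀ + ε • z - x₀‖ ^ 2 + ε ^ 2 = ε ^ 2 * (1 * ‖z - 0‖ ^ 2 + 1 ^ 2) := by
    rw [add_sub_cancel_left, norm_smul, Real.norm_of_nonneg hε.le, sub_zero]; ring
  have h2 : (ε ^ 2) ^ (-(((n : ℝ) + 2 * k) / 2)) = (ε ^ n * (ε ^ 2) ^ k)⁻¹ := by
    rw [Real.rpow_neg (by positivity), ← pow_mul, ← pow_add, ← Real.rpow_natCast ε (n + 2 * k),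
      ← Real.rpow_natCast ε 2, ← Real.rpow_mul hε.le]
    congr 2
    push_cast
    ring
  rw [h1, Real.mul_rpow (by positivity) (by positivity), h2]
  field_simp
  simp

lemma integral_mul_bubble {n k : ℕ} {ε : ℝ} (hε : 0 < ε) (x₀ : Rn n) (w : Rn n → ℝ) :
    ∫ y, w y * bubble n k ε x₀ y = ∫ z, w (x₀ + ε • z) * bubble n k 1 0 z := by
  have h := Measure.integral_comp_smul (volume : Measure (Rn n))
    (fun z => w (x₀ + z) * bubble n k ε x₀ (x₀ + z)) ε
  rw [integral_add_left_eq_self (fun y => w y * bubble n k ε x₀ y) x₀, finrank_euclideanSpace_fin,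
    abs_of_pos (by positivity), smul_eq_mul] at h
  have h2 : ∫ y, w y * bubble n k ε x₀ y =
      ε ^ n * ∫ z, w (x₀ + ε • z) * bubble n k ε x₀ (x₀ + ε • z) := by
    rw [h]; field_simp
  rw [h2, ← integral_const_mul]
  congr 1
  ext z
  rw [← bubble_comp_smul hε x₀ z]
  ring

/-- After rescaling to the unit bubble this is dominated convergence. Continuity is required only at
`x₀`, because `w` will be `u` times the indicator of a ball around `x₀`. -/
lemma tendsto_integral_mul_bubble {n k : ℕ} (hk : 1 ≤ k) (hkn : 2 * k < n) {w : Rn n → ℝ}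
    {M : ℝ} (hw : Measurable w) (hM : ∀ y, |w y| ≤ M) {x₀ : Rn n} (hc : ContinuousAt w x₀) :
    Tendsto (fun ε : ℝ => ∫ y, w y * bubble n k ε x₀ y) (𝓝[>] 0)
      (𝓝 (bubbleMass n k * w x₀)) := by
  have h1 : Tendsto (fun ε : ℝ => ∫ z, w (x₀ + ε • z) * bubble n k 1 0 z) (𝓝[>] 0)
      (𝓝 (∫ z, w x₀ * bubble n k 1 0 z)) := by
    refine tendsto_integral_filter_of_dominated_convergence (fun z => M * bubble n k 1 0 z) ?_ ?_
      ((integrable_bubble_one hk).const_mul M) ?_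
    · refine Eventually.of_forall fun ε => ?_
      have hm : Measurable fun z : Rn n => x₀ + ε • z := by fun_prop
      exact ((hw.comp hm).mul (continuous_bubble one_pos 0).measurable).aestronglyMeasurable
    · refine Eventually.of_forall fun ε => Eventually.of_forall fun z => ?_
      have := (bubble_pos hkn one_pos 0 z).le
      rw [norm_mul, Real.norm_of_nonneg this]
      gcongr
      exact hM _
    · refine Eventually.of_forall fun z => Tendsto.mul_const _ ?_
      have h2 : Tendsto (fun ε : ℝ => x₀ + ε • z) (𝓝[>] 0) (𝓝 x₀) := by
        have : Tendsto (fun ε : ℝ => x₀ + ε • z) (𝓝 0) (𝓝 (x₀ + (0 : ℝ) • z)) := by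
          apply Continuous.tendsto; fun_prop
        rw [zero_smul, add_zero] at this
        exact this.mono_left nhdsWithin_le_nhds
      exact hc.tendsto.comp h2
  rw [integral_const_mul, mul_comm] at h1
  refine h1.congr' ?_
  filter_upwards [self_mem_nhdsWithin] with ε hε
  exact (integral_mul_bubble hε x₀ w).symm

lemma negLaplacianPow_rpow_radialQuad {n k : ℕ} {ε : ℝ} (hε : 0 < ε) (x₀ : Rn n) :
    negLaplacianPow n k (fun y => (radialQuad 1 (ε ^ 2) x₀ y) ^ (-(((n : ℝ) - 2 * k) / 2))) =
      bubble n k ε x₀ := by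
  have hq : ∀ y, radialQuad 1 (ε ^ 2) x₀ y ∈ Set.Ioi (0 : ℝ) := fun y => by
    simp only [Set.mem_Ioi, radialQuad]; positivity
  rw [negLaplacianPow_comp_radialQuad k isOpen_Ioi hq
    (g := fun t : ℝ => t ^ (-(((n : ℝ) - 2 * k) / 2))) (contDiffOn_rpow_neg _ _)]
  ext y
  rw [iterate_negRadialLaplacian_bubble (hq y)]
  simp [bubble]

/-! ### Truncated fundamental solutions and the Riesz representation. -/

/-- A smooth antitone cutoff: `1` for `t ≤ 2`, `0` for `t ≥ 4`. -/
def radialCutoff (t : ℝ) : ℝ := Real.smoothTransition ((4 - t) / 2)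

lemma radialCutoff_eq_one {t : ℝ} (h : t ≤ 2) : radialCutoff t = 1 :=
  Real.smoothTransition.one_of_one_le (by linarith)

lemma radialCutoff_eq_zero {t : ℝ} (h : 4 ≤ t) : radialCutoff t = 0 :=
  Real.smoothTransition.zero_of_nonpos (by linarith)

lemma radialCutoff_nonneg (t : ℝ) : 0 ≤ radialCutoff t := Real.smoothTransition.nonneg _

lemma antitone_radialCutoff : Antitone radialCutoff := fun a b h =>
  Real.smoothTransition.monotone (by linarith)

lemma contDiff_radialCutoff : ContDiff ℝ ∞ radialCutoff :=
  Real.smoothTransition.contDiff.comp (by fun_prop)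

lemma continuous_radialCutoff : Continuous radialCutoff := contDiff_radialCutoff.continuous

/-- The truncated regularized fundamental solution `ρ^(-(n-2k)/2) χ(ρ/R²)`, where
`ρ = |y - x₀|² + ε²`. -/
def truncFundamental (n k : ℕ) (ε R : ℝ) (x₀ y : Rn n) : ℝ :=
  (radialQuad 1 (ε ^ 2) x₀ y) ^ (-(((n : ℝ) - 2 * k) / 2)) *
    radialCutoff (R⁻¹ ^ 2 * radialQuad 1 (ε ^ 2) x₀ y)

lemma radialQuad_pos {n : ℕ} {ε : ℝ} (hε : 0 < ε) (x₀ y : Rn n) :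
    0 < radialQuad 1 (ε ^ 2) x₀ y := by unfold radialQuad; positivity

lemma truncFundamental_nonneg {n k : ℕ} {ε R : ℝ} (x₀ y : Rn n) :
    0 ≤ truncFundamental n k ε R x₀ y := by
  refine mul_nonneg (Real.rpow_nonneg ?_ _) (radialCutoff_nonneg _)
  unfold radialQuad; positivity

lemma contDiff_truncFundamental {n k : ℕ} {m : ℕ} {ε R : ℝ} (hε : 0 < ε) (x₀ : Rn n) :
    ContDiff ℝ m (truncFundamental n k ε R x₀) := by
  refine ContDiff.mul ?_ ?_
  · exact (contDiff_radialQuad _ _ _).rpow_const_of_ne fun y => (radialQuad_pos hε x₀ y).ne'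
  · exact ((contDiff_infty.mp contDiff_radialCutoff) m).comp
      (contDiff_const.mul (contDiff_radialQuad _ _ _))

lemma truncFundamental_eq_zero {n k : ℕ} {ε R : ℝ} (hR : 0 < R) {x₀ y : Rn n}
    (hy : 2 * R ≤ ‖y - x₀‖) : truncFundamental n k ε R x₀ y = 0 := by
  unfold truncFundamental
  rw [radialCutoff_eq_zero, mul_zero]
  unfold radialQuad
  rw [inv_pow, le_inv_mul_iff₀ (by positivity)]
  have : (2 * R) ^ 2 ≤ ‖y - x₀‖ ^ 2 := by gcongr
  nlinarith [sq_nonneg ε]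

lemma hasCompactSupport_truncFundamental {n k : ℕ} {ε R : ℝ} (hR : 0 < R) (x₀ : Rn n) :
    HasCompactSupport (truncFundamental n k ε R x₀) :=
  HasCompactSupport.intro (isCompact_closedBall x₀ (2 * R)) fun y hy =>
    truncFundamental_eq_zero hR (by
      rw [mem_closedBall, dist_eq_norm, not_le] at hy; exact hy.le)

/-- In the variable `ρ/R²` the profile does not depend on `R` except for a prefactor `R^(-(n-2k))`.
-/
lemma truncFundamental_eq_comp {n k : ℕ} {ε R : ℝ} (hε : 0 < ε) (hR : 0 < R) (x₀ : Rn n) :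
    truncFundamental n k ε R x₀ = fun y =>
      (fun t : ℝ => (R⁻¹ ^ 2) ^ (((n : ℝ) - 2 * k) / 2) *
        (t ^ (-(((n : ℝ) - 2 * k) / 2)) * radialCutoff t))
        (radialQuad (R⁻¹ ^ 2) (R⁻¹ ^ 2 * ε ^ 2) x₀ y) := by
  ext y
  have h := radialQuad_pos hε x₀ y
  have e : radialQuad (R⁻¹ ^ 2) (R⁻¹ ^ 2 * ε ^ 2) x₀ y =
      R⁻¹ ^ 2 * radialQuad 1 (ε ^ 2) x₀ y := by unfold radialQuad; ring
  simp only [truncFundamental]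
  rw [e, Real.mul_rpow (by positivity) h.le, ← mul_assoc, ← mul_assoc,
    ← Real.rpow_add (by positivity),
    add_neg_cancel, Real.rpow_zero, one_mul]

/-- Inside the ball of radius `R` the truncation has no effect. -/
lemma negLaplacianPow_truncFundamental_of_le {n k : ℕ} {ε R : ℝ} (hε : 0 < ε) (hεR : ε < R)
    {x₀ y : Rn n} (hy : ‖y - x₀‖ ≤ R) :
    negLaplacianPow n k (truncFundamental n k ε R x₀) y = bubble n k ε x₀ y := by
  rw [← negLaplacianPow_rpow_radialQuad hε x₀]
  refine (negLaplacianPow_congr k ?_).eq_of_nhds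
  have hR : 0 < R := hε.trans hεR
  have hlt : R⁻¹ ^ 2 * radialQuad 1 (ε ^ 2) x₀ y < 2 := by
    rw [inv_pow, inv_mul_lt_iff₀ (by positivity)]
    unfold radialQuad
    have h1 : ‖y - x₀‖ ^ 2 ≤ R ^ 2 := by gcongr
    have h2 : ε ^ 2 < R ^ 2 := by gcongr
    linarith
  have hc : Continuous fun y => R⁻¹ ^ 2 * radialQuad 1 (ε ^ 2) x₀ y :=
    continuous_const.mul (continuous_radialQuad _ _ _)
  filter_upwards [hc.continuousAt.eventually (gt_mem_nhds hlt)] with z hz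
  rw [truncFundamental, radialCutoff_eq_one hz.le, mul_one]

lemma negLaplacianPow_truncFundamental_eq_zero {n k : ℕ} {ε R : ℝ} (hR : 0 < R)
    {x₀ y : Rn n} (hy : 2 * R < ‖y - x₀‖) :
    negLaplacianPow n k (truncFundamental n k ε R x₀) y = 0 := by
  have hc : Continuous fun z : Rn n => ‖z - x₀‖ := by fun_prop
  have hev : truncFundamental n k ε R x₀ =ᶠ[𝓝 y] fun _ => 0 := by
    filter_upwards [hc.continuousAt.eventually (lt_mem_nhds hy)] with z hz
    exact truncFundamental_eq_zero hR hz.le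
  rw [(negLaplacianPow_congr k hev).eq_of_nhds, negLaplacianPow_fun_zero]

/-- The prefactor `R^(-(n-2k))` and the `R^(-2k)` from `k` Laplacians combine to `R^(-n)`. The
rescaled variable exceeds `1` here; up to `4` the uniform bound applies with `e = ε²/R² ≤ 1`, and
past `4` the function vanishes. -/
lemma exists_abs_negLaplacianPow_truncFundamental_le (n k : ℕ) : ∃ C : ℝ, 0 ≤ C ∧
    ∀ (ε R : ℝ) (x₀ y : Rn n), 0 < ε → ε < R → R < ‖y - x₀‖ →
      |negLaplacianPow n k (truncFundamental n k ε R x₀) y| ≤ C * R⁻¹ ^ n := by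
  have hF : ∀ c : ℝ, ContDiffOn ℝ ∞ (fun t : ℝ => c * (t ^ (-(((n : ℝ) - 2 * k) / 2)) *
      radialCutoff t)) (Set.Ioi 0) := fun c =>
    contDiffOn_const.mul ((contDiffOn_rpow_neg _ _).mul contDiff_radialCutoff.contDiffOn)
  obtain ⟨C, hC, hb⟩ := exists_bound_iterate_negRadialLaplacian (n := n) k (hF 1)
  refine ⟨C, hC, fun ε R x₀ y hε hεR hy => ?_⟩
  have hR : 0 < R := hε.trans hεR
  have hq : ∀ y : Rn n, radialQuad (R⁻¹ ^ 2) (R⁻¹ ^ 2 * ε ^ 2) x₀ y ∈ Set.Ioi (0 : ℝ) := fun y => by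
    simp only [Set.mem_Ioi, radialQuad]; positivity
  rw [truncFundamental_eq_comp hε hR, negLaplacianPow_comp_radialQuad k isOpen_Ioi hq
    (contDiffOn_infty.mp (hF _) _)]
  simp only
  set c := (R⁻¹ ^ 2) ^ (((n : ℝ) - 2 * k) / 2) with hc
  set e := R⁻¹ ^ 2 * ε ^ 2
  set q := radialQuad (R⁻¹ ^ 2) e x₀ y with hqd
  have hcpos : 0 ≤ c := by positivity
  -- The prefactor depends on `R`, so it is pulled out of the iterate before the bound, whose
  -- constant must not depend on `R`.
  have hlin : ∀ j, Set.EqOn ((negRadialLaplacian n e)^[j] (fun t : ℝ =>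
      c * (t ^ (-(((n : ℝ) - 2 * k) / 2)) * radialCutoff t)))
      (fun t => c * (negRadialLaplacian n e)^[j] (fun t : ℝ =>
        1 * (t ^ (-(((n : ℝ) - 2 * k) / 2)) * radialCutoff t)) t) (Set.Ioi 0) := by
    intro j
    induction j with
    | zero => intro t _; simp
    | succ j ih =>
      intro t ht
      rw [Function.iterate_succ_apply', Function.iterate_succ_apply',
        eqOn_negRadialLaplacian isOpen_Ioi ih ht]
      have h2 := contDiffOn_iterate_negRadialLaplacian (n := n) (e := e) (m := 2) j isOpen_Ioi
        (contDiffOn_infty.mp (hF 1) _)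
      have := negRadialLaplacian_sum (n := n) (e := e) isOpen_Ioi {0} (fun _ => c)
        (fun _ => (negRadialLaplacian n e)^[j] (fun t : ℝ =>
          1 * (t ^ (-(((n : ℝ) - 2 * k) / 2)) * radialCutoff t))) (fun _ => h2) ht
      simpa using this
  rw [hlin k (hq y)]
  have hq1 : 1 < q := by
    have : 1 < R⁻¹ ^ 2 * ‖y - x₀‖ ^ 2 := by
      rw [← mul_pow]
      refine one_lt_pow₀ ?_ two_ne_zero
      rw [lt_inv_mul_iff₀ hR]; linarith
    have h3 : 0 ≤ e := by positivity
    rw [hqd]; unfold radialQuad; linarith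
  have he : e ∈ Set.Icc (0 : ℝ) 1 := by
    refine ⟨by positivity, ?_⟩
    have e1 : e = (R⁻¹ * ε) ^ 2 := by rw [mul_pow]
    rw [e1]
    refine pow_le_one₀ (by positivity) ?_
    rw [inv_mul_le_iff₀ hR]; linarith
  have hbound : |(negRadialLaplacian n e)^[k] (fun t : ℝ =>
        1 * (t ^ (-(((n : ℝ) - 2 * k) / 2)) * radialCutoff t)) q| ≤ C := by
    rcases le_or_gt q 4 with h4 | h4
    · exact hb e he q ⟨hq1.le, h4⟩
    · have h0 : Set.EqOn (fun t : ℝ => 1 * (t ^ (-(((n : ℝ) - 2 * k) / 2)) * radialCutoff t))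
          (fun _ => 0) (Set.Ioi 4) := fun t ht => by
        simp only
        rw [radialCutoff_eq_zero (le_of_lt ht), mul_zero, mul_zero]
      rw [eqOn_iterate_negRadialLaplacian k isOpen_Ioi h0 h4]
      have hz : ∀ j, (negRadialLaplacian n e)^[j] (fun _ : ℝ => (0 : ℝ)) = fun _ => 0 := by
        intro j
        induction j with
        | zero => rfl
        | succ j ih =>
          rw [Function.iterate_succ_apply', ih]
          ext t
          simp [negRadialLaplacian]
      rw [hz, abs_zero]
      exact hC
  have hcR : (R⁻¹ ^ 2) ^ k * c = R⁻¹ ^ n := by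
    rw [hc, ← Real.rpow_natCast _ k, ← Real.rpow_add (by positivity), ← Real.rpow_natCast R⁻¹ 2,
      ← Real.rpow_mul (by positivity), ← Real.rpow_natCast _ n]
    congr 1
    push_cast
    ring
  rw [abs_mul, abs_mul, abs_of_nonneg (by positivity), abs_of_nonneg hcpos, ← mul_assoc, hcR,
    mul_comm]
  gcongr

/-- After integration by parts the two integrands agree on the ball of radius `R`, so the difference
lives on the annulus `R < |y - x₀| ≤ 2R`, where the iterated Laplacian is `O(R^(-n))`. The constant
serves all `ε < R` at once. -/
lemma exists_abs_integral_truncFundamental_sub_le {n : ℕ} (k : ℕ) (hkn : 2 * k < n) :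
    ∃ C : ℝ, 0 ≤ C ∧ ∀ (u h : Rn n → ℝ), PolyharmonicAwayFromZero n k u h →
      ∀ (ε R : ℝ) (x₀ : Rn n), 0 < ε → ε < R →
        Integrable (fun y => h y * truncFundamental n k ε R x₀ y) ∧
        |(∫ y, h y * truncFundamental n k ε R x₀ y) -
          ∫ y, (closedBall x₀ R).indicator u y * bubble n k ε x₀ y| ≤
        C * R⁻¹ ^ n * ∫ y in closedBall x₀ (2 * R), u y := by
  obtain ⟨C, hC, hb⟩ := exists_abs_negLaplacianPow_truncFundamental_le n k
  refine ⟨C, hC, fun u h hu ε R x₀ hε hεR => ?_⟩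
  have hR : 0 < R := hε.trans hεR
  have hsm : ContDiff ℝ ((2 * k : ℕ) : ℕ∞ω) (truncFundamental n k ε R x₀) :=
    contDiff_truncFundamental hε x₀
  have hcs : HasCompactSupport (truncFundamental n k ε R x₀) :=
    hasCompactSupport_truncFundamental hR x₀
  have hweak := integral_mul_negLaplacianPow_of_nonneg hkn hu.cont hu.smooth hu.eq hu.rhs_nonneg
    hsm hcs (truncFundamental_nonneg x₀)
  refine ⟨hweak.1, ?_⟩
  have hi1 : Integrable (fun y => u y * negLaplacianPow n k (truncFundamental n k ε R x₀) y) :=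
    (hu.cont.mul (continuous_negLaplacianPow hsm)).integrable_of_hasCompactSupport
      (hcs.negLaplacianPow k).mul_left
  have hi2 : Integrable (fun y => (closedBall x₀ R).indicator u y * bubble n k ε x₀ y) := by
    have e : (fun y => (closedBall x₀ R).indicator u y * bubble n k ε x₀ y) =
        (closedBall x₀ R).indicator (fun y => u y * bubble n k ε x₀ y) := by
      ext y; by_cases hy : y ∈ closedBall x₀ R <;> simp [hy]
    rw [e, integrable_indicator_iff measurableSet_closedBall]
    exact (hu.cont.mul (continuous_bubble hε x₀)).continuousOn.integrableOn_compact
      (isCompact_closedBall _ _)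
  rw [← hweak.2, ← integral_sub hi1 hi2, ← integral_const_mul,
    ← integral_indicator measurableSet_closedBall, ← Real.norm_eq_abs]
  refine norm_integral_le_of_norm_le ?_ (Eventually.of_forall fun y => ?_)
  · rw [integrable_indicator_iff measurableSet_closedBall]
    exact (continuous_const.mul hu.cont).continuousOn.integrableOn_compact
      (isCompact_closedBall _ _)
  · have hnn : 0 ≤ (closedBall x₀ (2 * R)).indicator (fun y => C * R⁻¹ ^ n * u y) y :=
      Set.indicator_nonneg (fun y _ => mul_nonneg (by positivity) (hu.nonneg y)) y
    by_cases hy : y ∈ closedBall x₀ R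
    · rw [Set.indicator_of_mem hy,
        negLaplacianPow_truncFundamental_of_le hε hεR (by rwa [mem_closedBall, dist_eq_norm] at hy),
        sub_self, norm_zero]
      exact hnn
    · rw [Set.indicator_of_notMem hy, zero_mul, sub_zero]
      rw [mem_closedBall, dist_eq_norm, not_le] at hy
      by_cases hy2 : y ∈ closedBall x₀ (2 * R)
      · rw [Set.indicator_of_mem hy2, norm_mul, Real.norm_of_nonneg (hu.nonneg y), mul_comm]
        exact mul_le_mul_of_nonneg_right (hb ε R x₀ y hε hεR hy) (hu.nonneg y)
      · rw [mem_closedBall, dist_eq_norm, not_le] at hy2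
        rw [negLaplacianPow_truncFundamental_eq_zero hR hy2, mul_zero, norm_zero]
        exact hnn

lemma tendsto_integral_indicator_mul_bubble {n k : ℕ} (hk : 1 ≤ k) (hkn : 2 * k < n)
    {u : Rn n → ℝ} (hu : Continuous u) {R : ℝ} (hR : 0 < R) (x₀ : Rn n) :
    Tendsto (fun ε : ℝ => ∫ y, (closedBall x₀ R).indicator u y * bubble n k ε x₀ y) (𝓝[>] 0)
      (𝓝 (bubbleMass n k * u x₀)) := by
  obtain ⟨M, hM⟩ := (isCompact_closedBall x₀ R).exists_bound_of_continuousOn hu.continuousOn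
  have hM0 : 0 ≤ M := (norm_nonneg _).trans (hM x₀ (mem_closedBall_self hR.le))
  have h := tendsto_integral_mul_bubble hk hkn (w := (closedBall x₀ R).indicator u) (M := M)
    (hu.measurable.indicator measurableSet_closedBall) (fun y => ?_) (x₀ := x₀) ?_
  · rwa [Set.indicator_of_mem (mem_closedBall_self hR.le)] at h
  · by_cases hy : y ∈ closedBall x₀ R
    · rw [Set.indicator_of_mem hy]; exact hM y hy
    · rw [Set.indicator_of_notMem hy, abs_zero]; exact hM0
  · refine hu.continuousAt.congr ?_
    filter_upwards [closedBall_mem_nhds x₀ hR] with y hy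
    rw [Set.indicator_of_mem hy]

/-- Recentring: once `R ≥ |x₀|`, the ball of radius `2R` about `x₀` lies in the ball of radius `3R`
about the origin. -/
lemma tendsto_inv_pow_mul_setIntegral_closedBall {n : ℕ} {u : Rn n → ℝ} (hu : Continuous u)
    (hu0 : ∀ x, 0 ≤ u x)
    (hdecay : ∀ ε : ℝ, 0 < ε → ∀ᶠ R : ℝ in atTop, ∫ y in closedBall (0 : Rn n) R, u y ≤ ε * R ^ n)
    (x₀ : Rn n) :
    Tendsto (fun R : ℝ => R⁻¹ ^ n * ∫ y in closedBall x₀ (2 * R), u y) atTop (𝓝 0) := by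
  rw [Metric.tendsto_nhds]
  intro δ hδ
  have h1 := (tendsto_id.const_mul_atTop (zero_lt_three' ℝ)).eventually
    (hdecay (δ / (2 * 3 ^ n)) (by positivity))
  filter_upwards [h1, eventually_ge_atTop ‖x₀‖, eventually_gt_atTop 0] with R hR hRx hR0
  have hI0 : 0 ≤ ∫ y in closedBall x₀ (2 * R), u y := integral_nonneg fun y => hu0 y
  have hI : ∫ y in closedBall x₀ (2 * R), u y ≤ ∫ y in closedBall (0 : Rn n) (3 * R), u y := by
    refine setIntegral_mono_set (hu.continuousOn.integrableOn_compact (isCompact_closedBall _ _))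
      (Eventually.of_forall fun y => hu0 y) (LE.le.eventuallyLE ?_)
    exact closedBall_subset_closedBall' (by rw [dist_zero_right]; linarith)
  rw [dist_zero_right, Real.norm_of_nonneg (by positivity)]
  calc R⁻¹ ^ n * ∫ y in closedBall x₀ (2 * R), u y
      ≤ R⁻¹ ^ n * (δ / (2 * 3 ^ n) * (3 * R) ^ n) := by
        gcongr; exact hI.trans hR
    _ = δ / 2 := by rw [mul_pow, inv_pow]; field_simp
    _ < δ := by linarith

/-- The truncated fundamental solution `|y - x₀|^(-(n-2k)) χ(|y - x₀|²/R²)`. -/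
lemma truncFundamental_zero {n k : ℕ} {R : ℝ} {x₀ y : Rn n} :
    truncFundamental n k 0 R x₀ y =
      ‖y - x₀‖ ^ (-((n : ℝ) - 2 * k)) * radialCutoff (R⁻¹ ^ 2 * ‖y - x₀‖ ^ 2) := by
  have e : radialQuad 1 (0 ^ 2) x₀ y = ‖y - x₀‖ ^ 2 := by simp [radialQuad]
  rw [truncFundamental, e, ← Real.rpow_natCast _ 2, ← Real.rpow_mul (norm_nonneg _)]
  congr 2
  push_cast
  ring

/-- Both factors decrease in `ε`, the cutoff being antitone; this permits monotone convergence as `ε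
→ 0` without any prior integrability of the singular kernel against `h`. -/
lemma truncFundamental_anti {n k : ℕ} (hkn : 2 * k < n) {ε ε' R : ℝ} (hε : 0 < ε) (h : ε ≤ ε')
    (x₀ y : Rn n) : truncFundamental n k ε' R x₀ y ≤ truncFundamental n k ε R x₀ y := by
  have hq : radialQuad 1 (ε ^ 2) x₀ y ≤ radialQuad 1 (ε' ^ 2) x₀ y := by
    unfold radialQuad; gcongr
  have hkn' : (2 : ℝ) * k < n := by exact_mod_cast hkn
  refine mul_le_mul (Real.rpow_le_rpow_of_nonpos (radialQuad_pos hε x₀ y) hq (by linarith))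
    (antitone_radialCutoff ?_) (radialCutoff_nonneg _)
    (Real.rpow_nonneg (radialQuad_pos hε x₀ y).le _)
  gcongr

lemma tendsto_truncFundamental_zero {n k : ℕ} {R : ℝ} {x₀ y : Rn n} (hy : y ≠ x₀) :
    Tendsto (fun ε => truncFundamental n k ε R x₀ y) (𝓝 0) (𝓝 (truncFundamental n k 0 R x₀ y)) := by
  have hq : Continuous fun ε : ℝ => radialQuad 1 (ε ^ 2) x₀ y := by unfold radialQuad; fun_prop
  have h0 : radialQuad 1 ((0 : ℝ) ^ 2) x₀ y ≠ 0 := by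
    have := norm_pos_iff.mpr (sub_ne_zero.mpr hy)
    unfold radialQuad; positivity
  exact (hq.continuousAt.rpow_const (Or.inl h0)).mul
    (continuous_radialCutoff.continuousAt.comp (continuous_const.mul hq).continuousAt)

/-- If in addition the averages of `u` over large balls tend to zero, then `u` is the Riesz
potential of `(-Δ)^k u`. -/
theorem lintegral_riesz_eq {n k : ℕ} (hk : 1 ≤ k) (hkn : 2 * k < n) {u h : Rn n → ℝ}
    (hu : PolyharmonicAwayFromZero n k u h)
    (hdecay : ∀ ε : ℝ, 0 < ε → ∀ᶠ R : ℝ in atTop, ∫ y in closedBall (0 : Rn n) R, u y ≤ ε * R ^ n)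
    (hm : AEMeasurable h) (x₀ : Rn n) :
    ∫⁻ y, ENNReal.ofReal (h y * ‖y - x₀‖ ^ (-((n : ℝ) - 2 * k))) =
      ENNReal.ofReal (bubbleMass n k * u x₀) := by
  have : Nontrivial (Rn n) := by
    have : Nonempty (Fin n) := ⟨⟨0, by omega⟩⟩
    infer_instance
  have hae0 : ∀ᵐ x : Rn n, x ≠ 0 := by simp [ae_iff, measure_singleton]
  have hae1 : ∀ᵐ x : Rn n, x ≠ x₀ := by simp [ae_iff, measure_singleton]
  obtain ⟨C, hC, hb⟩ := exists_abs_integral_truncFundamental_sub_le k hkn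
  set E : ℝ → ℝ := fun R => C * R⁻¹ ^ n * ∫ y in closedBall x₀ (2 * R), u y with hE
  have hElim : Tendsto E atTop (𝓝 0) := by
    have := (tendsto_inv_pow_mul_setIntegral_closedBall hu.cont hu.nonneg hdecay x₀).const_mul C
    rw [mul_zero] at this
    exact this.congr fun R => by rw [hE]; ring
  have hmeasT : ∀ ε R : ℝ, Measurable (truncFundamental n k ε R x₀) := fun ε R => by
    have h1 : Measurable (radialQuad 1 (ε ^ 2) x₀) := (continuous_radialQuad _ _ _).measurable
    exact (h1.pow_const _).mul (continuous_radialCutoff.measurable.comp (h1.const_mul _))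
  -- the limit `ε → 0` at fixed `R`
  have hJ : ∀ R : ℝ, 1 ≤ R →
      ENNReal.ofReal (bubbleMass n k * u x₀ - E R) ≤
        ∫⁻ y, ENNReal.ofReal (h y * truncFundamental n k 0 R x₀ y) ∧
      ∫⁻ y, ENNReal.ofReal (h y * truncFundamental n k 0 R x₀ y) ≤
        ENNReal.ofReal (bubbleMass n k * u x₀ + E R) := by
    intro R hR
    -- The factor `1/2` keeps every `ε j` strictly below `R`, already for `R = 1`.
    let ε : ℕ → ℝ := fun j => 1 / ((j : ℝ) + 1) / 2
    have hε0 : ∀ j, 0 < ε j := fun j => by positivity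
    have hεR : ∀ j, ε j < R := fun j => by
      have : 1 / ((j : ℝ) + 1) ≤ 1 := by
        rw [div_le_one (by positivity)]; linarith [Nat.cast_nonneg (α := ℝ) j]
      simp only [ε]; linarith
    have hεl0 : Tendsto ε atTop (𝓝 0) := by
      simpa [ε] using (tendsto_one_div_add_atTop_nhds_zero_nat (𝕜 := ℝ)).div_const 2
    have hεl : Tendsto ε atTop (𝓝[>] 0) :=
      tendsto_nhdsWithin_iff.mpr ⟨hεl0, Eventually.of_forall hε0⟩
    have hεanti : Antitone ε := fun i j hij => by
      simp only [ε]; gcongr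
    have hL := (tendsto_integral_indicator_mul_bubble hk hkn hu.cont
      (by linarith : 0 < R) x₀).comp hεl
    have hmono := lintegral_tendsto_of_tendsto_of_monotone (μ := volume)
      (f := fun j y => ENNReal.ofReal (h y * truncFundamental n k (ε j) R x₀ y))
      (F := fun y => ENNReal.ofReal (h y * truncFundamental n k 0 R x₀ y))
      (fun j => (hm.mul (hmeasT _ _).aemeasurable).ennreal_ofReal)
      (by
        filter_upwards [hae0] with y hy i j hij
        exact ENNReal.ofReal_le_ofReal (mul_le_mul_of_nonneg_left
          (truncFundamental_anti hkn (hε0 j) (hεanti hij) x₀ y) (hu.rhs_nonneg y hy)))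
      (by
        filter_upwards [hae1] with y hy
        exact ENNReal.tendsto_ofReal (((tendsto_truncFundamental_zero hy).comp hεl0).const_mul _))
    have heq : ∀ j, ∫⁻ y, ENNReal.ofReal (h y * truncFundamental n k (ε j) R x₀ y) =
        ENNReal.ofReal (∫ y, h y * truncFundamental n k (ε j) R x₀ y) := fun j => by
      rw [ofReal_integral_eq_lintegral_ofReal (hb u h hu (ε j) R x₀ (hε0 j) (hεR j)).1]
      filter_upwards [hae0] with y hy
      exact mul_nonneg (hu.rhs_nonneg y hy) (truncFundamental_nonneg x₀ y)
    have habs := fun j => abs_le.mp (hb u h hu (ε j) R x₀ (hε0 j) (hεR j)).2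
    refine ⟨le_of_tendsto_of_tendsto' (ENNReal.tendsto_ofReal (hL.sub_const (E R))) hmono
      fun j => ?_, le_of_tendsto_of_tendsto' hmono (ENNReal.tendsto_ofReal (hL.add_const (E R)))
      fun j => ?_⟩
    · rw [heq]
      refine ENNReal.ofReal_le_ofReal ?_
      have := (habs j).1
      simp only [Function.comp_apply]
      linarith
    · rw [heq]
      refine ENNReal.ofReal_le_ofReal ?_
      have := (habs j).2
      simp only [Function.comp_apply]
      linarith
  -- the limit `R → ∞`
  let r : ℕ → ℝ := fun j => (j : ℝ) + 1
  have hr1 : ∀ j, 1 ≤ r j := fun j => by simp [r]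
  have hrl : Tendsto r atTop atTop := tendsto_atTop_add_const_right _ _ tendsto_natCast_atTop_atTop
  have hmono := lintegral_tendsto_of_tendsto_of_monotone (μ := volume)
    (f := fun j y => ENNReal.ofReal (h y * truncFundamental n k 0 (r j) x₀ y))
    (F := fun y => ENNReal.ofReal (h y * ‖y - x₀‖ ^ (-((n : ℝ) - 2 * k))))
    (fun j => (hm.mul (hmeasT _ _).aemeasurable).ennreal_ofReal)
    (by
      filter_upwards [hae0] with y hy i j hij
      refine ENNReal.ofReal_le_ofReal (mul_le_mul_of_nonneg_left ?_ (hu.rhs_nonneg y hy))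
      rw [truncFundamental_zero, truncFundamental_zero]
      refine mul_le_mul_of_nonneg_left (antitone_radialCutoff ?_) (by positivity)
      have h1 : r i ≤ r j := by simp only [r]; gcongr
      have h2 : 0 < r i := by linarith [hr1 i]
      gcongr)
    (by
      refine Eventually.of_forall fun y => ENNReal.tendsto_ofReal (Tendsto.const_mul _ ?_)
      refine tendsto_const_nhds.congr' ?_
      filter_upwards [hrl.eventually_ge_atTop ‖y - x₀‖] with j hj
      have h2 : 0 < r j := by linarith [hr1 j]
      rw [truncFundamental_zero, radialCutoff_eq_one, mul_one]
      rw [← mul_pow]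
      have h3 : (r j)⁻¹ * ‖y - x₀‖ ≤ 1 := by rw [inv_mul_le_iff₀ h2]; linarith
      have h4 := pow_le_one₀ (n := 2) (by positivity) h3
      linarith)
  have hEr := hElim.comp hrl
  have hlow : Tendsto (fun j => ENNReal.ofReal (bubbleMass n k * u x₀ - E (r j))) atTop
      (𝓝 (ENNReal.ofReal (bubbleMass n k * u x₀))) := by
    have := ENNReal.tendsto_ofReal (hEr.const_sub (bubbleMass n k * u x₀))
    simpa using this
  have hupp : Tendsto (fun j => ENNReal.ofReal (bubbleMass n k * u x₀ + E (r j))) atTop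
      (𝓝 (ENNReal.ofReal (bubbleMass n k * u x₀))) := by
    have := ENNReal.tendsto_ofReal (hEr.const_add (bubbleMass n k * u x₀))
    simpa using this
  exact tendsto_nhds_unique hmono (tendsto_of_tendsto_of_tendsto_of_le_of_le hlow hupp
    (fun j => (hJ _ (hr1 j)).1) (fun j => (hJ _ (hr1 j)).2))

/-! ### From Riesz potentials back to the differential equation. -/

lemma integrable_rpow_norm_sub_mul {n k : ℕ} (hk : 1 ≤ k) (hkn : 2 * k < n) {g : Rn n → ℝ}
    (hg : Continuous g) (hc : HasCompactSupport g) (y : Rn n) :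
    Integrable (fun x => ‖x - y‖ ^ (-((n : ℝ) - 2 * k)) * g x) := by
  have hk' : (1 : ℝ) ≤ k := by exact_mod_cast hk
  have hloc : LocallyIntegrable (fun x : Rn n => ‖x‖ ^ (-((n : ℝ) - 2 * k))) volume := by
    refine locallyIntegrable_of_norm_le_rpow (C := 1) (α := (n : ℝ) - 2 * k) ?_ ?_ ?_ ?_
    · rw [finrank_euclideanSpace_fin]; omega
    · rw [finrank_euclideanSpace_fin]; linarith
    · refine Eventually.of_forall fun x => ?_
      rw [Real.norm_of_nonneg (by positivity), one_mul]
    · exact (measurable_norm.pow_const _).aestronglyMeasurable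
  have hcs : HasCompactSupport fun x => g (x + y) := hc.comp_homeomorph (Homeomorph.addRight y)
  have h := hloc.integrable_smul_right_of_hasCompactSupport
    (hg.comp (continuous_add_const y)) hcs
  have h2 := h.comp_sub_right y
  refine h2.congr (Eventually.of_forall fun x => ?_)
  simp

/-- `|x - y|^(-(n-2k))` is a fundamental solution of `(-Δ)^k`, up to the factor `bubbleMass`. -/
lemma integral_rpow_norm_sub_mul_negLaplacianPow {n k : ℕ} (hk : 1 ≤ k) (hkn : 2 * k < n)
    {φ : Rn n → ℝ} (hφ : ContDiff ℝ ((2 * k : ℕ) : ℕ∞ω) φ) (hc : HasCompactSupport φ) (y : Rn n) :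
    ∫ x, ‖x - y‖ ^ (-((n : ℝ) - 2 * k)) * negLaplacianPow n k φ x = bubbleMass n k * φ y := by
  have : Nontrivial (Rn n) := by
    have : Nonempty (Fin n) := ⟨⟨0, by omega⟩⟩
    infer_instance
  have hkn' : (2 : ℝ) * k < n := by exact_mod_cast hkn
  have hae : ∀ᵐ x : Rn n, x ≠ y := by simp [ae_iff, measure_singleton]
  have hzero : ∀ x : Rn n, (radialQuad 1 (0 ^ 2) y x) ^ (-(((n : ℝ) - 2 * k) / 2)) =
      ‖x - y‖ ^ (-((n : ℝ) - 2 * k)) := by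
    intro x
    have e : radialQuad 1 (0 ^ 2) y x = ‖x - y‖ ^ 2 := by simp [radialQuad]
    rw [e, ← Real.rpow_natCast _ 2, ← Real.rpow_mul (norm_nonneg _)]
    congr 1
    push_cast
    ring
  obtain ⟨M, hM⟩ := hφ.continuous.bounded_above_of_compact_support hc
  have hR := tendsto_integral_mul_bubble hk hkn hφ.continuous.measurable hM
    (hφ.continuous.continuousAt (x := y))
  have hsym : ∀ ε : ℝ, 0 < ε → ∫ x, (radialQuad 1 (ε ^ 2) y x) ^ (-(((n : ℝ) - 2 * k) / 2)) *
      negLaplacianPow n k φ x = ∫ x, φ x * bubble n k ε y x := by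
    intro ε hε
    rw [integral_mul_negLaplacianPow k _ hφ hc, negLaplacianPow_rpow_radialQuad hε]
    · simp only [mul_comm]
    · exact (contDiff_radialQuad _ _ _).rpow_const_of_ne fun x => (radialQuad_pos hε y x).ne'
  have hΛc := continuous_negLaplacianPow hφ
  have hL : Tendsto (fun ε : ℝ => ∫ x, (radialQuad 1 (ε ^ 2) y x) ^ (-(((n : ℝ) - 2 * k) / 2)) *
      negLaplacianPow n k φ x) (𝓝[>] 0)
      (𝓝 (∫ x, ‖x - y‖ ^ (-((n : ℝ) - 2 * k)) * negLaplacianPow n k φ x)) := by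
    -- The regularized kernels lie below the singular one, which is locally integrable and so
    -- dominates against a compactly supported factor.
    refine tendsto_integral_filter_of_dominated_convergence
      (fun x => ‖‖x - y‖ ^ (-((n : ℝ) - 2 * k)) * negLaplacianPow n k φ x‖) ?_ ?_
      (integrable_rpow_norm_sub_mul hk hkn hΛc (hc.negLaplacianPow k) y).norm ?_
    · refine Eventually.of_forall fun ε => ?_
      exact ((((continuous_radialQuad 1 (ε ^ 2) y).measurable.pow_const _)).mul
        hΛc.measurable).aestronglyMeasurable
    · filter_upwards [self_mem_nhdsWithin] with ε hε
      filter_upwards [hae] with x hx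
      rw [norm_mul, norm_mul, Real.norm_of_nonneg (Real.rpow_nonneg (radialQuad_pos hε y x).le _),
        Real.norm_of_nonneg (Real.rpow_nonneg (norm_nonneg (x - y)) _), ← hzero]
      refine mul_le_mul_of_nonneg_right
        (Real.rpow_le_rpow_of_nonpos ?_ ?_ (by linarith)) (norm_nonneg _)
      · have := norm_pos_iff.mpr (sub_ne_zero.mpr hx)
        unfold radialQuad; positivity
      · unfold radialQuad
        have := sq_nonneg ε
        linarith
    · filter_upwards [hae] with x hx
      rw [← hzero]
      have hq : Continuous fun ε : ℝ => radialQuad 1 (ε ^ 2) y x := by unfold radialQuad; fun_prop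
      have h0 : radialQuad 1 ((0 : ℝ) ^ 2) y x ≠ 0 := by
        have := norm_pos_iff.mpr (sub_ne_zero.mpr hx)
        unfold radialQuad; positivity
      have h1 : Tendsto (fun ε : ℝ => (radialQuad 1 (ε ^ 2) y x) ^ (-(((n : ℝ) - 2 * k) / 2)))
          (𝓝 0) (𝓝 ((radialQuad 1 (0 ^ 2) y x) ^ (-(((n : ℝ) - 2 * k) / 2)))) :=
        (hq.continuousAt.rpow_const (Or.inl h0))
      exact (h1.mono_left nhdsWithin_le_nhds).mul_const _
  refine tendsto_nhds_unique hL (hR.congr' ?_)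
  filter_upwards [self_mem_nhdsWithin] with ε hε
  exact (hsym ε hε).symm

/-- A Riesz potential that is `C^{2k}` away from the origin solves the differential equation. -/
theorem negLaplacianPow_eq_of_riesz {n k : ℕ} (hk : 1 ≤ k) (hkn : 2 * k < n) {u h : Rn n → ℝ}
    (hu : Continuous u) (hus : ContDiffOn ℝ ((2 * k : ℕ) : ℕ∞ω) u {x | x ≠ 0})
    (hm : Measurable h) (hc : ContinuousOn h {x | x ≠ 0}) (hpos : ∀ x, x ≠ 0 → 0 ≤ h x)
    (hint : ∀ x, x ≠ 0 → Integrable (fun y => ‖x - y‖ ^ (-((n : ℝ) - 2 * k)) * h y))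
    (heq : ∀ x, x ≠ 0 → u x = (bubbleMass n k)⁻¹ * ∫ y, ‖x - y‖ ^ (-((n : ℝ) - 2 * k)) * h y) :
    ∀ x, x ≠ 0 → negLaplacianPow n k u x = h x := by
  have : Nontrivial (Rn n) := by
    have : Nonempty (Fin n) := ⟨⟨0, by omega⟩⟩
    infer_instance
  have hmass := bubbleMass_pos hk hkn
  have hae : ∀ᵐ x : Rn n, x ≠ 0 := by simp [ae_iff, measure_singleton]
  have hopen : IsOpen {x : Rn n | x ≠ 0} := isOpen_ne
  have hLu := continuousOn_negLaplacianPow hus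
  -- It is enough to test against smooth functions supported off the origin; both sides are
  -- continuous there, so equality almost everywhere becomes equality everywhere.
  have hae' : ∀ᵐ x : Rn n, x ∈ {x : Rn n | x ≠ 0} → negLaplacianPow n k u x - h x = 0 := by
    refine hopen.ae_eq_zero_of_integral_contDiff_smul_eq_zero
      ((hLu.sub hc).locallyIntegrableOn hopen.measurableSet) fun φ hφ hφc hφs => ?_
    have hφ2 : ContDiff ℝ ((2 * k : ℕ) : ℕ∞ω) φ := contDiff_infty.mp hφ _
    have h0 : (0 : Rn n) ∉ tsupport φ := fun h => hφs h rfl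
    have hΛc := continuous_negLaplacianPow hφ2
    have hΛs := hφc.negLaplacianPow k
    obtain ⟨hI1, hS⟩ := integral_mul_negLaplacianPow_of_zero_notMem_tsupport hus hφ2 hφc h0
    have hF : Integrable (Function.uncurry fun x y : Rn n =>
        ‖x - y‖ ^ (-((n : ℝ) - 2 * k)) * h y * negLaplacianPow n k φ x)
        (volume.prod volume) := by
      have hmeas : Measurable (Function.uncurry fun x y : Rn n =>
          ‖x - y‖ ^ (-((n : ℝ) - 2 * k)) * h y * negLaplacianPow n k φ x) := by
        refine Measurable.mul (Measurable.mul ?_ (hm.comp measurable_snd))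
          (hΛc.measurable.comp measurable_fst)
        exact (measurable_norm.comp (measurable_fst.sub measurable_snd)).pow_const _
      refine (integrable_prod_iff hmeas.aestronglyMeasurable).mpr ⟨?_, ?_⟩
      · filter_upwards [hae] with x hx
        exact (hint x hx).mul_const (negLaplacianPow n k φ x)
      -- Fubini's hypothesis comes from the integral equation itself: as the kernel and `h` are
      -- nonnegative, the inner absolute integral is the mass times `u x`, a continuous function,
      -- times a factor of compact support.
      · have hI : Integrable (fun x => bubbleMass n k * u x * ‖negLaplacianPow n k φ x‖) :=
          ((continuous_const.mul hu).mul hΛc.norm).integrable_of_hasCompactSupport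
            hΛs.norm.mul_left
        refine hI.congr ?_
        filter_upwards [hae] with x hx
        rw [heq x hx, mul_inv_cancel_left₀ hmass.ne', ← integral_mul_const]
        refine integral_congr_ae ?_
        filter_upwards [hae] with y hy
        simp only [Function.uncurry_apply_pair]
        rw [norm_mul, Real.norm_of_nonneg (mul_nonneg (by positivity) (hpos y hy))]
    have hswap := integral_integral_swap hF
    have hleft : ∫ x, ∫ y, ‖x - y‖ ^ (-((n : ℝ) - 2 * k)) * h y * negLaplacianPow n k φ x =
        bubbleMass n k * ∫ x, u x * negLaplacianPow n k φ x := by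
      rw [← integral_const_mul]
      refine integral_congr_ae ?_
      filter_upwards [hae] with x hx
      rw [integral_mul_const, heq x hx, ← mul_assoc, mul_inv_cancel_left₀ hmass.ne']
    have hinner : ∀ y, ∫ x, ‖x - y‖ ^ (-((n : ℝ) - 2 * k)) * h y * negLaplacianPow n k φ x =
        bubbleMass n k * (h y * φ y) := by
      intro y
      have := integral_rpow_norm_sub_mul_negLaplacianPow hk hkn hφ2 hφc y
      rw [show bubbleMass n k * (h y * φ y) = h y * (bubbleMass n k * φ y) by ring, ← this,
        ← integral_const_mul]
      congr 1
      ext x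
      ring
    rw [hleft, integral_congr_ae (Eventually.of_forall hinner), integral_const_mul] at hswap
    have hfin := mul_left_cancel₀ hmass.ne' hswap
    rw [hS] at hfin
    have hI2 : Integrable (fun x => h x * φ x) := by
      have hcont : Continuous (fun x => h x * φ x) := by
        rw [continuous_iff_continuousAt]
        intro x
        by_cases hx : x = 0
        · subst hx
          have : (fun x => h x * φ x) =ᶠ[𝓝 0] fun _ => 0 := by
            filter_upwards [notMem_tsupport_iff_eventuallyEq.mp h0] with z hz
            simp [hz]
          exact continuousAt_const.congr this.symm
        · exact (hc.continuousAt (hopen.mem_nhds hx)).mul hφ.continuous.continuousAt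
      exact hcont.integrable_of_hasCompactSupport hφc.mul_left
    have e : (fun x => φ x • (negLaplacianPow n k u x - h x)) =
        fun x => negLaplacianPow n k u x * φ x - h x * φ x := by
      ext x; simp only [smul_eq_mul]; ring
    rw [e, integral_sub hI1 hI2, hfin, sub_self]
  have hrest : negLaplacianPow n k u =ᵐ[volume.restrict {x : Rn n | x ≠ 0}] h := by
    refine (ae_restrict_iff' hopen.measurableSet).mpr ?_
    filter_upwards [hae'] with x hx hx0
    exact sub_eq_zero.mp (hx hx0)
  exact fun x hx => Measure.eqOn_open_of_ae_eq hrest hopen hLu hc hx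

/-! ### The systems, and scaling under quasi-homogeneity. -/

/-- The right-hand side `|y|^(-σ_i) f_i(y, u(y))`. -/
def weightedRhs {n L : ℕ} (σ : Fin L → ℝ) (f : Fin L → Rn n → (Fin L → ℝ) → ℝ)
    (u : Fin L → Rn n → ℝ) (i : Fin L) (y : Rn n) : ℝ := ‖y‖ ^ (-σ i) * f i y (fun j => u j y)

lemma rieszIntegrand_eq {n k L : ℕ} (σ : Fin L → ℝ) (f : Fin L → Rn n → (Fin L → ℝ) → ℝ)
    (u : Fin L → Rn n → ℝ) (i : Fin L) (x : Rn n) :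
    rieszIntegrand n k L σ f u i x =
      fun y => ‖x - y‖ ^ (-((n : ℝ) - 2 * k)) * weightedRhs σ f u i y := by
  ext y
  rw [rieszIntegrand, weightedRhs, Real.rpow_neg (norm_nonneg _), Real.rpow_neg (norm_nonneg _),
    one_div, mul_inv]
  ring

section

variable {n k L : ℕ} {σ : Fin L → ℝ} {f : Fin L → Rn n → (Fin L → ℝ) → ℝ} {u : Fin L → Rn n → ℝ}

lemma continuous_comp_of_positiveClassical (hf : AdmissibleData n k L σ f)
    (hu : PositiveClassical n k L u) (i : Fin L) : Continuous fun y => f i y (fun j => u j y) :=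
  (hf.smooth i).continuousOn.comp_continuous
    (f := fun y : Rn n => (y, fun j => u j y))
    (continuous_id.prodMk (continuous_pi hu.cont)) fun y j => hu.pos j y

lemma measurable_weightedRhs (hf : AdmissibleData n k L σ f) (hu : PositiveClassical n k L u)
    (i : Fin L) : Measurable (weightedRhs σ f u i) :=
  (measurable_norm.pow_const _).mul (continuous_comp_of_positiveClassical hf hu i).measurable

lemma continuousOn_weightedRhs (hf : AdmissibleData n k L σ f) (hu : PositiveClassical n k L u)
    (i : Fin L) : ContinuousOn (weightedRhs σ f u i) {x | x ≠ 0} :=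
  (continuous_norm.continuousOn.rpow_const fun _ hx => Or.inl (norm_ne_zero_iff.mpr hx)).mul
    (continuous_comp_of_positiveClassical hf hu i).continuousOn

lemma weightedRhs_nonneg (hf : AdmissibleData n k L σ f) (hu : PositiveClassical n k L u)
    (i : Fin L) (y : Rn n) : 0 ≤ weightedRhs σ f u i y :=
  mul_nonneg (Real.rpow_nonneg (norm_nonneg _) _) (hf.pos i y _ fun j => hu.pos j y).le

lemma contDiffOn_of_positiveClassical (hu : PositiveClassical n k L u) (i : Fin L) :
    ContDiffOn ℝ ((2 * k : ℕ) : ℕ∞ω) (u i) {x | x ≠ 0} := hu.smooth i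

/-- The representation was proved for the lower Lebesgue integral of a nonnegative function, so its
finite value yields convergence and the identity together. -/
lemma integralSolution_of_differentialSolution (hk : 1 ≤ k) (hkn : 2 * k < n)
    (hf : AdmissibleData n k L σ f) (hg : GrowthCondition n k L σ f u)
    (hu : IsDifferentialSolution n k L σ f u) :
    IsIntegralSolutionOn n k L σ f (bubbleMass n k)⁻¹ Set.univ u := by
  obtain ⟨hP, hD⟩ := hu
  obtain ⟨p, s, C, hp, hs0, hs, hC, hgrow⟩ := hg
  have hpoly : ∀ i, PolyharmonicAwayFromZero n k (u i) (weightedRhs σ f u i) := fun i =>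
    ⟨hP.cont i, fun x => (hP.pos i x).le, contDiffOn_of_positiveClassical hP i, hD i,
      fun x _ => weightedRhs_nonneg hf hP i x⟩
  have hmass := bubbleMass_pos hk hkn
  refine ⟨hP, fun i x _ => ?_⟩
  have hl := lintegral_riesz_eq hk hkn (hpoly i)
    (fun ε hε => eventually_setIntegral_closedBall_le hkn hpoly hp hs0 hs hC hgrow i hε)
    (measurable_weightedRhs hf hP i).aemeasurable x
  have e : rieszIntegrand n k L σ f u i x =
      fun y => weightedRhs σ f u i y * ‖y - x‖ ^ (-((n : ℝ) - 2 * k)) := by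
    rw [rieszIntegrand_eq]
    ext y
    rw [norm_sub_rev, mul_comm]
  have hnn : ∀ y, 0 ≤ weightedRhs σ f u i y * ‖y - x‖ ^ (-((n : ℝ) - 2 * k)) := fun y =>
    mul_nonneg (weightedRhs_nonneg hf hP i y) (by positivity)
  have hmeas : Measurable fun y => weightedRhs σ f u i y * ‖y - x‖ ^ (-((n : ℝ) - 2 * k)) :=
    (measurable_weightedRhs hf hP i).mul ((measurable_id.sub_const x).norm.pow_const _)
  rw [e]
  refine ⟨⟨hmeas.aestronglyMeasurable, ?_⟩, ?_⟩
  · rw [hasFiniteIntegral_iff_ofReal (Eventually.of_forall hnn), hl]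
    exact ENNReal.ofReal_lt_top
  · rw [integral_eq_lintegral_of_nonneg_ae (Eventually.of_forall hnn) hmeas.aestronglyMeasurable,
      hl, ENNReal.toReal_ofReal (mul_nonneg hmass.le (hP.pos i x).le),
      inv_mul_cancel_left₀ hmass.ne']

lemma differentialSolution_of_integralSolution (hk : 1 ≤ k) (hkn : 2 * k < n)
    (hf : AdmissibleData n k L σ f)
    (hu : IsIntegralSolutionOn n k L σ f (bubbleMass n k)⁻¹ {x | x ≠ 0} u) :
    IsDifferentialSolution n k L σ f u := by
  obtain ⟨hP, hI⟩ := hu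
  refine ⟨hP, fun i => negLaplacianPow_eq_of_riesz (h := weightedRhs σ f u i) hk hkn (hP.cont i)
    (contDiffOn_of_positiveClassical hP i) (measurable_weightedRhs hf hP i)
    (continuousOn_weightedRhs hf hP i) (fun x _ => weightedRhs_nonneg hf hP i x)
    (fun x hx => ?_) (fun x hx => ?_)⟩
  · rw [← rieszIntegrand_eq]
    exact (hI i x hx).1
  · rw [← rieszIntegrand_eq]
    exact (hI i x hx).2

lemma PositiveClassical.const_mul (hu : PositiveClassical n k L u) {t : Fin L → ℝ}
    (ht : ∀ i, 0 < t i) : PositiveClassical n k L (fun i x => t i * u i x) :=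
  ⟨fun i x => mul_pos (ht i) (hu.pos i x), fun i => continuous_const.mul (hu.cont i),
    fun i => contDiffOn_const.mul (hu.smooth i)⟩

/-- Under quasi-homogeneity the constant in the integral system can be changed by scaling. -/
lemma IsIntegralSolutionOn.scale {c : ℝ} {D : Set (Rn n)} {a : Fin L → ℝ}
    (ha : QuasiHomogeneous n L f a) (hu : IsIntegralSolutionOn n k L σ f c D u) {r : ℝ}
    (hr : 0 < r) :
    IsIntegralSolutionOn n k L σ f (c * r⁻¹) D (fun i x => r ^ (a i) * u i x) := by
  obtain ⟨hP, hI⟩ := hu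
  refine ⟨hP.const_mul fun i => Real.rpow_pos_of_pos hr _, fun i x hx => ?_⟩
  have e : rieszIntegrand n k L σ f (fun i x => r ^ (a i) * u i x) i x =
      fun y => r ^ (a i + 1) * rieszIntegrand n k L σ f u i x y := by
    ext y
    rw [rieszIntegrand, rieszIntegrand, ha i y _ (fun j => hP.pos j y) r hr]
    ring
  obtain ⟨h1, h2⟩ := hI i x hx
  rw [e]
  refine ⟨h1.const_mul _, ?_⟩
  change r ^ a i * u i x = _
  rw [integral_const_mul, h2, Real.rpow_add_one hr.ne']
  field_simp

end

end
theorem theorem1 (n k : ℕ) (hn : 3 ≤ n) (hk : 1 ≤ k) (hkn : 2 * k < n) :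
    ∃ c : ℝ, 0 < c ∧
      ∀ (L : ℕ) (σ : Fin L → ℝ) (f : Fin L → Rn n → (Fin L → ℝ) → ℝ),
        AdmissibleData n k L σ f →
          -- the two systems have the same positive solutions, with the constant `c`
          -- in front of the integrals
          (∀ u : Fin L → Rn n → ℝ, GrowthCondition n k L σ f u →
            (IsDifferentialSolution n k L σ f u →
              IsIntegralSolutionOn n k L σ f c Set.univ u) ∧
            (IsIntegralSolutionOn n k L σ f c {x | x ≠ 0} u →
              IsDifferentialSolution n k L σ f u)) ∧
          -- where the constant can be absorbed by scaling, it can be moved to the solutions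
          (∀ a : Fin L → ℝ, QuasiHomogeneous n L f a →
            ∃ t : Fin L → ℝ, (∀ i, 0 < t i) ∧
              ∀ u : Fin L → Rn n → ℝ, GrowthCondition n k L σ f u →
                (IsIntegralSolutionOn n k L σ f 1 {x | x ≠ 0} u →
                  IsDifferentialSolution n k L σ f (fun i x => t i * u i x)) ∧
                (IsDifferentialSolution n k L σ f u →
                  IsIntegralSolutionOn n k L σ f 1 Set.univ (fun i x => (t i)⁻¹ * u i x))) := by
  have hmass := bubbleMass_pos hk hkn
  refine ⟨(bubbleMass n k)⁻¹, inv_pos.mpr hmass, fun L σ f hf => ⟨fun u hg =>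
    ⟨integralSolution_of_differentialSolution hk hkn hf hg,
      differentialSolution_of_integralSolution hk hkn hf⟩, fun a ha =>
    -- Scaling by `r = bubbleMass` turns the constant `1` into `1 / bubbleMass`, and `r = 1 /
    -- bubbleMass` undoes this.
    ⟨fun i => bubbleMass n k ^ a i, fun i => Real.rpow_pos_of_pos hmass _, fun u hg =>
      ⟨fun hu => ?_, fun hu => ?_⟩⟩⟩⟩
  · refine differentialSolution_of_integralSolution hk hkn hf ?_
    simpa using hu.scale ha hmass
  · have h := (integralSolution_of_differentialSolution hk hkn hf hg hu).scale ha
      (inv_pos.mpr hmass)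
    rw [inv_inv, inv_mul_cancel₀ hmass.ne'] at h
    simpa only [Real.inv_rpow hmass.le] using h
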